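/- Let $d\ge 2$ and let $\mathcal P_n$ be the space of real polynomials in $d$ variables of total degree at most $n$. For a compact set $D\subset\mathbb R^d$ with non-empty interior, and an orthonormal basis $\phi_1,\dots,\phi_N$ of $\mathcal P_n$ with respect to the inner product $\int_D fg\,dx$ (Lebesgue measure), let \[ C(\mathcal P_n,D,x)=\sum_{k=1}^N\phi_k(x)^2,\qquad C(\mathcal P_n,D)=\sup_{x\in D}C(\mathcal P_n,D,x); \] these do not depend on the choice of the basis. Write $a(n)\approx b(n)$ if there is a constant $c>0$ independent of $n$ with $c^{-1}b(n)\le a(n)\le c\,b(n)$ for all integers $n\ge 1$. For $1\le p\le\infty$ let $B_p^d=\{x\in\mathbb R^d:\|x\|_p\le 1\}$ be the closed unit ball of the $\ell_p$ norm, and put \[ \sigma=\begin{cases}2+\frac2p(d-1), & 1\le p\le 2,\\ d+1, & 2\le p<\infty,\\ 2d, & p=\infty.\end{cases} \] Then, with constants that may depend on $d$ and $p$, \[ C(\mathcal P_n,B_p^d)\approx n^{\sigma}\qquad\text{and}\qquad \sup_{\phi\in\mathcal P_n\setminus\{0\}}\frac{\|\phi\|_{L_\infty(B_p^d)}}{\|\phi\|_{L_2(B_p^d)}}\approx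 n^{\sigma/2}. \] Consequently, for every real $\sigma$ with $d+1\le\sigma\le 2d$ there is a convex body $D\subset\mathbb R^d$ (a compact convex set with non-empty interior) with $C(\mathcal P_n,D)\approx n^{\sigma}$ and $\sup_{\phi\in\mathcal P_n\setminus\{0\}}\|\phi\|_{L_\infty(D)}/\|\phi\|_{L_2(D)}\approx n^{\sigma/2}$. -/

import Mathlib

open MeasureTheory
open scoped ENNReal NNReal

/-- The space `𝒫_n` of (restrictions to points of `ℝ^d` of) real algebraic polynomials in `d`
variables of total degree at most `n`, as a space of functions on `ℝ^d`. -/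
def polySpace (d n : ℕ) : Submodule ℝ ((Fin d → ℝ) → ℝ) where
  carrier := {f | ∃ P : MvPolynomial (Fin d) ℝ, P.totalDegree ≤ n ∧ ∀ x, f x = MvPolynomial.eval x P}
  add_mem' := by
    rintro f g ⟨P, hP, hf⟩ ⟨Q, hQ, hg⟩
    exact ⟨P + Q, (MvPolynomial.totalDegree_add P Q).trans (max_le hP hQ),
      fun x => by simp [hf x, hg x]⟩
  zero_mem' := ⟨0, by simp, fun x => by simp⟩
  smul_mem' := by
    rintro a f ⟨P, hP, hf⟩
    exact ⟨a • P, (MvPolynomial.totalDegree_smul_le a P).trans hP,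
      fun x => by simp [hf x, MvPolynomial.smul_eval]⟩

/-- The finite family `φ` is an orthonormal basis of the function space `S` with respect to the
inner product `⟨f, g⟩ = ∫ f g dμ` (linear independence follows from orthonormality). -/
structure IsOrthonormalBasisFor {X ι : Type*} [MeasurableSpace X] [DecidableEq ι]
    (S : Submodule ℝ (X → ℝ)) (μ : Measure X) (φ : ι → X → ℝ) : Prop where
  memLp : ∀ i, MemLp (φ i) 2 μ
  integral_mul : ∀ i j, ∫ x, φ i x * φ j x ∂μ = if i = j then 1 else 0
  span_eq : Submodule.span ℝ (Set.range φ) = S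

open Classical in
/-- The inverse Christoffel function `C(S, μ, x) = ∑ₖ φₖ(x)²`, where `(φₖ)` is a finite orthonormal
basis of `S` in `L²(μ)`. It does not depend on the basis: see
`IsOrthonormalBasisFor.christoffelInv_eq`. (The value is `0` if there is no such basis.) -/
noncomputable def christoffelInv {X : Type*} [MeasurableSpace X]
    (S : Submodule ℝ (X → ℝ)) (μ : Measure X) (x : X) : ℝ :=
  if h : ∃ (N : ℕ) (φ : Fin N → X → ℝ), IsOrthonormalBasisFor S μ φ then
    ∑ k, h.choose_spec.choose k x ^ 2
  else 0

theorem IsOrthonormalBasisFor.eq_sum {X ι : Type*} [MeasurableSpace X] [DecidableEq ι] [Fintype ι]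
    {S : Submodule ℝ (X → ℝ)} {μ : Measure X} {φ : ι → X → ℝ}
    (h : IsOrthonormalBasisFor S μ φ) {f : X → ℝ} (hf : f ∈ S) (x : X) :
    f x = ∑ i, (∫ y, f y * φ i y ∂μ) * φ i x := by
  rw [← h.span_eq, Submodule.mem_span_range_iff_exists_fun] at hf
  obtain ⟨c, rfl⟩ := hf
  have key : ∀ i, ∫ y, (∑ j, c j • φ j) y * φ i y ∂μ = c i := by
    intro i
    have hint : ∀ j ∈ Finset.univ, Integrable (fun y => c j * (φ j y * φ i y)) μ := fun j _ =>
      ((h.memLp j).integrable_mul (h.memLp i)).const_mul (c j)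
    calc ∫ y, (∑ j, c j • φ j) y * φ i y ∂μ
        = ∫ y, ∑ j, c j * (φ j y * φ i y) ∂μ := by
          simp only [Finset.sum_apply, Pi.smul_apply, smul_eq_mul, Finset.sum_mul, mul_assoc]
      _ = c i := by
          rw [integral_finsetSum _ hint]
          simp [integral_const_mul, h.integral_mul]
  simp only [key]
  simp [Finset.sum_apply]

theorem IsOrthonormalBasisFor.sum_sq_eq {X ι κ : Type*} [MeasurableSpace X]
    [DecidableEq ι] [Fintype ι] [DecidableEq κ] [Fintype κ]
    {S : Submodule ℝ (X → ℝ)} {μ : Measure X} {φ : ι → X → ℝ} {ψ : κ → X → ℝ}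
    (hφ : IsOrthonormalBasisFor S μ φ) (hψ : IsOrthonormalBasisFor S μ ψ) (x : X) :
    ∑ i, φ i x ^ 2 = ∑ j, ψ j x ^ 2 := by
  have mφ : ∀ i, φ i ∈ S := fun i => hφ.span_eq ▸ Submodule.subset_span ⟨i, rfl⟩
  have mψ : ∀ j, ψ j ∈ S := fun j => hψ.span_eq ▸ Submodule.subset_span ⟨j, rfl⟩
  calc ∑ i, φ i x ^ 2
      = ∑ i, ∑ j, (∫ y, φ i y * ψ j y ∂μ) * ψ j x * φ i x := by
        refine Finset.sum_congr rfl fun i _ => ?_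
        rw [sq, ← Finset.sum_mul, ← hψ.eq_sum (mφ i) x]
    _ = ∑ j, ∑ i, (∫ y, ψ j y * φ i y ∂μ) * φ i x * ψ j x := by
        rw [Finset.sum_comm]
        refine Finset.sum_congr rfl fun j _ => Finset.sum_congr rfl fun i _ => ?_
        simp only [mul_comm (φ i _) (ψ j _)]
        ring
    _ = ∑ j, ψ j x ^ 2 := by
        refine Finset.sum_congr rfl fun j _ => ?_
        rw [sq, ← Finset.sum_mul, ← hφ.eq_sum (mψ j) x]

/-- The inverse Christoffel function may be computed from any finite orthonormal basis. -/
theorem IsOrthonormalBasisFor.christoffelInv_eq {X : Type*} [MeasurableSpace X]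
    {S : Submodule ℝ (X → ℝ)} {μ : Measure X} {N : ℕ} {φ : Fin N → X → ℝ}
    (h : IsOrthonormalBasisFor S μ φ) (x : X) :
    christoffelInv S μ x = ∑ k, φ k x ^ 2 := by
  have h' : ∃ (N : ℕ) (φ : Fin N → X → ℝ), IsOrthonormalBasisFor S μ φ := ⟨N, φ, h⟩
  rw [christoffelInv, dif_pos h']
  exact h'.choose_spec.choose_spec.sum_sq_eq h x

/-- `C(𝒫_n, D) = sup_{x ∈ D} C(𝒫_n, D, x)`, for Lebesgue measure on `D ⊆ ℝ^d`. -/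
noncomputable def christoffelSup {d : ℕ} (D : Set (Fin d → ℝ)) (n : ℕ) : ℝ≥0∞ :=
  ⨆ x ∈ D, ENNReal.ofReal (christoffelInv (polySpace d n) (volume.restrict D) x)

/-- `sup ‖φ‖_{L_∞(D)} / ‖φ‖_{L_2(D)}` over the nonzero polynomials `φ ∈ 𝒫_n`. -/
noncomputable def nikolskiiSup {d : ℕ} (D : Set (Fin d → ℝ)) (n : ℕ) : ℝ≥0∞ :=
  ⨆ φ ∈ {φ : (Fin d → ℝ) → ℝ | φ ∈ polySpace d n ∧ φ ≠ 0},
    eLpNorm φ ∞ (volume.restrict D) / eLpNorm φ 2 (volume.restrict D)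

/-- `a(n) ≈ n^s`: for some constant `c > 0`, `c⁻¹ n^s ≤ a(n) ≤ c n^s` for all `n ≥ 1`. -/
def ApproxPow (a : ℕ → ℝ≥0∞) (s : ℝ) : Prop :=
  ∃ c : ℝ≥0, 0 < c ∧ ∀ n : ℕ, 1 ≤ n →
    ((c⁻¹ : ℝ≥0) : ℝ≥0∞) * (n : ℝ≥0∞) ^ s ≤ a n ∧ a n ≤ (c : ℝ≥0∞) * (n : ℝ≥0∞) ^ s

/-- The closed unit ball `B_p^d` of the `ℓ_p` norm on `ℝ^d`. -/
def lpUnitBall (d : ℕ) (p : ℝ≥0∞) : Set (Fin d → ℝ) :=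
  {x | ‖WithLp.toLp p x‖ ≤ 1}

/-- The exponent `σ` of the ball `B_p^d`. -/
noncomputable def lpBallExponent (d : ℕ) (p : ℝ≥0∞) : ℝ :=
  if p ≤ 2 then 2 + 2 / p.toReal * ((d : ℝ) - 1)
  else if p < ∞ then (d : ℝ) + 1
  else 2 * (d : ℝ)

/-! `C(𝒫_n, D, x)` is the best constant `C` in `f(x)² ≤ C ∫_D f²`. Both claims therefore follow from
such an inequality with `C = O(n^σ)` at all points of `D`, together with one family of polynomials
peaked at a single point `x₀` (`approxPow_christoffelSup_nikolskiiSup`).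

Upper bound. On the Euclidean unit ball the constant is `O(n^(d+1))`. Follow parabolas inward from a
maximum point of `|f|`: along each one `f` is a polynomial of degree at most `2n` in `t` with an
extremum at `t = 0`. Its even part is a polynomial of degree at most `n` in `t²`, so Markov's
inequality keeps `|f|` above half its maximum for `|t| ≤ 1/(4n)`. The arcs sweep out a set of
thickness about `n⁻²` in one direction and `n⁻¹` in the other `d - 1`
(`polySpace_exists_large_set`). The argument tolerates points `O(n⁻²)` outside the ball, and an
affine image under `T` divides the constant by `|det T|`. It remains to put every `x ∈ D` in or very
near an ellipsoid inside `D` with `|det T|` at least a constant times `n^(d+1-σ)`: a centred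
axis-parallel ellipsoid for `p ≤ 2`, a ball of radius bounded below for `2 ≤ p < ∞`, a needle along
a diagonal for the cube.

Lower bound. Compose a power of a Fejér-type kernel with a linear functional that attains its
maximum `1` over `D` at `x₀`. If caps of height `u` at `x₀` have width `O(u^γ)`, their volume is
`O(u^(1+γ(d-1)))`, and a dyadic sum gives `∫ f² = O(n^(-2(1+γ(d-1))))`. At a coordinate vector `γ =
1/p` (`p ≤ 2`), at the diagonal point `γ = 1/2` (`2 ≤ p < ∞`), at a vertex of the cube `γ = 1`; in
each case `2(1+γ(d-1)) = σ`.

As `p` runs through `[1, 2]` the exponent sweeps `[d+1, 2d]`, which gives the last claim. -/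

/-! ### One variable: Markov-type estimates and a peaked polynomial. -/

/-- Markov's inequality at the right end point of `[-1, 1]`. -/
theorem Polynomial.abs_eval_derivative_one_le {n : ℕ} {P : Polynomial ℝ} {M : ℝ} (hM : 0 < M)
    (hdeg : P.natDegree ≤ n) (hP : ∀ x ∈ Set.Icc (-1 : ℝ) 1, |P.eval x| ≤ M) :
    |P.derivative.eval 1| ≤ n ^ 2 * M := by
  have key : ∀ Q : Polynomial ℝ, Q.natDegree ≤ n → (∀ x ∈ Set.Icc (-1 : ℝ) 1, |Q.eval x| ≤ M) →
      Q.derivative.eval 1 ≤ n ^ 2 * M := by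
    intro Q hdeg hQ
    have h := Polynomial.Chebyshev.eval_iterate_derivative_le_of_forall_abs_le_one
      (n := n) (P := Polynomial.C M⁻¹ * Q) (k := 1) le_rfl
      ((Polynomial.degree_le_of_natDegree_le (Polynomial.natDegree_C_mul_le _ _)).trans
        (by exact_mod_cast hdeg))
      (fun x hx => by
        rw [Polynomial.eval_mul, Polynomial.eval_C, abs_mul, abs_of_pos (inv_pos.2 hM),
          inv_mul_le_iff₀ hM, mul_one]
        exact hQ x hx)
    simp only [Function.iterate_one, Polynomial.Chebyshev.derivative_T_eval_one,
      Polynomial.derivative_C_mul, Polynomial.eval_mul, Polynomial.eval_C] at h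
    rw [inv_mul_le_iff₀ hM] at h
    push_cast at h
    linarith
  refine abs_le.2 ⟨?_, key P hdeg hP⟩
  have := key (-P) (by simpa using hdeg) (fun x hx => by simpa using hP x hx)
  simp at this
  linarith

/-- A polynomial bounded by `M` on `[0, 1]` decreases slowly away from the end point `0`. -/
theorem Polynomial.eval_zero_sub_le {n : ℕ} {r : Polynomial ℝ} {M : ℝ} (hM : 0 < M)
    (hdeg : r.natDegree ≤ n) (hr : ∀ x ∈ Set.Icc (0 : ℝ) 1, |r.eval x| ≤ M)
    {u : ℝ} (hu0 : 0 ≤ u) (hu : u ≤ 1 / 2) :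
    r.eval 0 - r.eval u ≤ 4 * n ^ 2 * M * u := by
  rcases hu0.eq_or_lt with rfl | hu0
  · simp
  obtain ⟨v, ⟨hv0, hvu⟩, hv⟩ := exists_hasDerivAt_eq_slope (fun x => r.eval x)
    (fun x => r.derivative.eval x) hu0 r.continuous.continuousOn (fun x _ => r.hasDerivAt x)
  -- The substitution `x ↦ v + a(1 - x)` carries `[-1, 1]` onto `[v, 1]` and `1` to `v`, so Markov
  -- bounds `a|r'(v)|`; since `v < 1/2`, dividing by `a ≥ 1/4` costs the factor 4.
  set a : ℝ := (1 - v) / 2 with ha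
  have ha0 : 1 / 4 ≤ a := by rw [ha]; linarith
  have hd := Polynomial.abs_eval_derivative_one_le (n := n)
    (P := r.comp (Polynomial.C (v + a) - Polynomial.C a * Polynomial.X)) hM
    (by
      refine Polynomial.natDegree_comp_le.trans ?_
      have : (Polynomial.C (v + a) - Polynomial.C a * Polynomial.X).natDegree ≤ 1 := by
        compute_degree
      nlinarith)
    (fun x hx => by
      rw [Polynomial.eval_comp]
      apply hr
      simp only [Polynomial.eval_sub, Polynomial.eval_C, Polynomial.eval_mul, Polynomial.eval_X]
      obtain ⟨h1, h2⟩ := hx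
      constructor <;> nlinarith)
  simp only [Polynomial.derivative_comp, Polynomial.derivative_sub, Polynomial.derivative_C,
    Polynomial.derivative_C_mul, Polynomial.derivative_X, Polynomial.eval_mul, Polynomial.eval_comp,
    Polynomial.eval_sub, Polynomial.eval_C, Polynomial.eval_X, mul_one, add_sub_cancel_right,
    zero_sub, Polynomial.eval_neg, abs_mul, abs_neg] at hd
  rw [abs_of_pos (by linarith : 0 < a)] at hd
  have h1 : |r.derivative.eval v| ≤ 4 * n ^ 2 * M := by
    nlinarith [abs_nonneg (r.derivative.eval v)]
  have h2 : r.eval u - r.eval 0 = r.derivative.eval v * u := by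
    rw [hv]; field_simp; ring
  nlinarith [abs_le.1 h1]

/-- Keeping the even coefficients isolates the even part of `p`, read as a polynomial in `t²`. This
turns an interior extremum at `0` into an extremum at the end point of `[0, 1]`, where Markov's
inequality applies. -/
theorem Polynomial.eval_contract_two (p : Polynomial ℝ) (t : ℝ) :
    2 * (Polynomial.contract 2 p).eval (t ^ 2) = p.eval t + p.eval (-t) := by
  induction p using Polynomial.induction_on' with
  | add p q hp hq =>
    rw [Polynomial.contract_add two_ne_zero]
    simp only [Polynomial.eval_add]
    linarith
  | monomial k a =>
    rcases Nat.even_or_odd' k with ⟨m, rfl | rfl⟩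
    · have : Polynomial.contract 2 (Polynomial.monomial (2 * m) a) = Polynomial.monomial m a := by
        ext i
        rw [Polynomial.coeff_contract two_ne_zero, Polynomial.coeff_monomial,
          Polynomial.coeff_monomial]
        congr 1
        apply propext
        omega
      rw [this]
      simp only [Polynomial.eval_monomial, ← pow_mul, (even_two_mul m).neg_pow]
      ring
    · have : Polynomial.contract 2 (Polynomial.monomial (2 * m + 1) a) = 0 := by
        ext i
        rw [Polynomial.coeff_contract two_ne_zero, Polynomial.coeff_monomial, if_neg (by omega)]
        simp
      rw [this]
      simp [(odd_two_mul_add_one m).neg_pow]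

theorem Polynomial.natDegree_contract_two_le {p : Polynomial ℝ} {n : ℕ}
    (hp : p.natDegree ≤ 2 * n) : (Polynomial.contract 2 p).natDegree ≤ n := by
  rw [Polynomial.natDegree_le_iff_coeff_eq_zero]
  intro N hN
  rw [Polynomial.coeff_contract two_ne_zero]
  exact Polynomial.coeff_eq_zero_of_natDegree_lt (by omega)

/-- A polynomial of degree at most `2n` with an interior maximum of its modulus stays large
at distance `O(1/n)`. -/
theorem Polynomial.half_le_eval_of_isMax {n : ℕ} (hn : 1 ≤ n) {p : Polynomial ℝ} {M : ℝ}
    (hM : 0 < M) (hdeg : p.natDegree ≤ 2 * n) (hp : ∀ t ∈ Set.Icc (-1 : ℝ) 1, |p.eval t| ≤ M)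
    (h0 : p.eval 0 = M) {t : ℝ} (ht : t ^ 2 ≤ (1 / (4 * n)) ^ 2) : M / 2 ≤ p.eval t := by
  have hn' : (1 : ℝ) ≤ n := by exact_mod_cast hn
  have hsq : (1 / (4 * n : ℝ)) ^ 2 * n ^ 2 = 1 / 16 := by field_simp; norm_num
  have hle : (1 / (4 * n : ℝ)) ^ 2 ≤ 1 / 16 := by
    nlinarith [mul_nonneg (sq_nonneg (1 / (4 * n : ℝ))) (by nlinarith : (0 : ℝ) ≤ n ^ 2 - 1)]
  have hr : ∀ x ∈ Set.Icc (0 : ℝ) 1, |(Polynomial.contract 2 p).eval x| ≤ M := by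
    rintro x ⟨hx0, hx1⟩
    have e := Polynomial.eval_contract_two p (Real.sqrt x)
    rw [Real.sq_sqrt hx0] at e
    have hs : Real.sqrt x ≤ 1 := Real.sqrt_le_one.2 hx1
    have hs0 := Real.sqrt_nonneg x
    have b1 := abs_le.1 (hp (Real.sqrt x) ⟨by linarith, hs⟩)
    have b2 := abs_le.1 (hp (-Real.sqrt x) ⟨by linarith, by linarith⟩)
    exact abs_le.2 ⟨by linarith, by linarith⟩
  have h1 := Polynomial.eval_zero_sub_le hM (Polynomial.natDegree_contract_two_le hdeg) hr
    (sq_nonneg t) (by linarith)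
  have e0 := Polynomial.eval_contract_two p 0
  have et := Polynomial.eval_contract_two p t
  rw [neg_zero, h0, zero_pow two_ne_zero] at e0
  have h2 : 4 * (n : ℝ) ^ 2 * M * t ^ 2 ≤ M / 4 := by
    have : (n : ℝ) ^ 2 * t ^ 2 ≤ 1 / 16 := by nlinarith [sq_nonneg (n : ℝ)]
    nlinarith
  -- The even part is still at least `3M/4` at `t`; as `p(-t) ≤ M`, this leaves `p(t) ≥ M/2`.
  have hb := abs_le.1 (hp (-t) ⟨by nlinarith, by nlinarith⟩)
  linarith

/-- A Fejér type polynomial concentrated at the end point `1` of `[-1, 1]`. -/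
theorem Polynomial.exists_concentrated {m : ℕ} (hm : 1 ≤ m) :
    ∃ F : Polynomial ℝ, F.natDegree ≤ m - 1 ∧ F.eval 1 = 1 ∧
      ∀ t ∈ Set.Icc (-1 : ℝ) 1, |F.eval t| ≤ 1 ∧ |F.eval t| * (m ^ 2 * (1 - t)) ≤ 2 := by
  -- The polynomial is `(T_m - 1) / (m² (X - 1))`, the Fejér kernel in the variable `cos θ`. The
  -- bound 1 comes from `|T_m'| ≤ m²`, the decay from `|T_m - 1| ≤ 2`.
  set T := Polynomial.Chebyshev.T ℝ m with hT
  have hm' : (0 : ℝ) < m ^ 2 := by positivity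
  have hroot : (T - 1).IsRoot 1 := by simp [hT]
  obtain ⟨G, hG⟩ := Polynomial.dvd_iff_isRoot.2 hroot
  have hT1 : T.derivative.eval 1 = m ^ 2 := by
    rw [hT, Polynomial.Chebyshev.derivative_T_eval_one]; simp
  have hG1 : G.eval 1 = m ^ 2 := by
    have : (T - 1).derivative.eval 1 = m ^ 2 := by simp [hT1]
    rw [hG] at this
    simpa using this
  have hGne : G ≠ 0 := by
    rintro rfl
    rw [Polynomial.eval_zero] at hG1
    exact hm'.ne hG1
  have hGdeg : G.natDegree ≤ m - 1 := by
    have h1 : (T - 1).natDegree ≤ m := by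
      refine (Polynomial.natDegree_sub_le _ _).trans ?_
      rw [hT, Polynomial.Chebyshev.natDegree_T]
      simp
    rw [hG, Polynomial.natDegree_mul (Polynomial.X_sub_C_ne_zero 1) hGne,
      Polynomial.natDegree_X_sub_C] at h1
    omega
  have hev : ∀ t, T.eval t - 1 = (t - 1) * G.eval t := fun t => by
    simpa using congrArg (Polynomial.eval t) hG
  refine ⟨Polynomial.C ((m : ℝ) ^ 2)⁻¹ * G, (Polynomial.natDegree_C_mul_le _ _).trans hGdeg, ?_, ?_⟩
  · rw [Polynomial.eval_mul, Polynomial.eval_C, hG1, inv_mul_cancel₀ hm'.ne']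
  rintro t ⟨ht0, ht1⟩
  have hval : |(Polynomial.C ((m : ℝ) ^ 2)⁻¹ * G).eval t| = ((m : ℝ) ^ 2)⁻¹ * |G.eval t| := by
    rw [Polynomial.eval_mul, Polynomial.eval_C, abs_mul, abs_of_pos (inv_pos.2 hm')]
  rw [hval]
  have habs : |T.eval t - 1| = (1 - t) * |G.eval t| := by
    rw [hev, abs_mul, abs_sub_comm, abs_of_nonneg (by linarith)]
  constructor
  · rw [inv_mul_le_iff₀ hm', mul_one]
    rcases ht1.eq_or_lt with rfl | ht
    · rw [hG1, abs_of_pos hm']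
    have hl : |T.eval 1 - T.eval t| ≤ m ^ 2 * |1 - t| := by
      have := Convex.norm_image_sub_le_of_norm_hasDerivWithin_le (f := fun x => T.eval x)
        (f' := fun x => T.derivative.eval x) (s := Set.Icc (-1 : ℝ) 1) (C := m ^ 2)
        (fun x _ => (T.hasDerivAt x).hasDerivWithinAt)
        (fun x hx => by
          have := Polynomial.Chebyshev.abs_iterate_derivative_T_real_le m 1 (abs_le.2 hx)
          simp only [Function.iterate_one] at this
          rw [← hT, hT1] at this
          exact this)
        (convex_Icc _ _) ⟨ht0, ht1⟩ (⟨by norm_num, le_rfl⟩ : (1 : ℝ) ∈ Set.Icc (-1 : ℝ) 1)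
      simpa using this
    have hT11 : T.eval 1 = 1 := by simp [hT]
    rw [hT11, abs_sub_comm, habs, abs_of_pos (by linarith : 0 < 1 - t), mul_comm] at hl
    exact le_of_mul_le_mul_right hl (by linarith)
  · have h2 : |T.eval t - 1| ≤ 2 := by
      have := abs_le.1 (Polynomial.Chebyshev.abs_eval_T_real_le_one m (abs_le.2 ⟨ht0, ht1⟩))
      rw [← hT] at this
      exact abs_le.2 ⟨by linarith, by linarith⟩
    calc ((m : ℝ) ^ 2)⁻¹ * |G.eval t| * (m ^ 2 * (1 - t)) = (1 - t) * |G.eval t| := by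
          field_simp
      _ ≤ 2 := habs ▸ h2

/-! ### Polynomial spaces under affine maps and along polynomial curves. -/

theorem MvPolynomial.totalDegree_bind₁_le {σ τ : Type*} {m k : ℕ} (P : MvPolynomial σ ℝ)
    (hP : P.totalDegree ≤ m) (g : σ → MvPolynomial τ ℝ) (hg : ∀ i, (g i).totalDegree ≤ k) :
    (MvPolynomial.bind₁ g P).totalDegree ≤ m * k := by
  rw [MvPolynomial.bind₁, MvPolynomial.aeval_def, MvPolynomial.eval₂]
  refine MvPolynomial.totalDegree_finsetSum_le fun s hs => ?_
  have h1 : (∑ i ∈ s.support, s i) ≤ m := (MvPolynomial.le_totalDegree hs).trans hP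
  refine (MvPolynomial.totalDegree_mul _ _).trans ?_
  rw [MvPolynomial.algebraMap_eq, MvPolynomial.totalDegree_C, zero_add]
  refine (MvPolynomial.totalDegree_finsetProd _ _).trans ?_
  refine le_trans (Finset.sum_le_sum fun i _ => (MvPolynomial.totalDegree_pow _ _).trans
    (Nat.mul_le_mul_left _ (hg i))) ?_
  rw [← Finset.sum_mul]
  exact Nat.mul_le_mul_right _ h1

theorem polySpace_continuous {d n : ℕ} {f : (Fin d → ℝ) → ℝ} (hf : f ∈ polySpace d n) :
    Continuous f := by
  obtain ⟨P, -, h⟩ := hf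
  rw [funext h]
  exact MvPolynomial.continuous_eval P

theorem polySpace_comp_affine {d n : ℕ} {f : (Fin d → ℝ) → ℝ} (hf : f ∈ polySpace d n)
    (c : Fin d → ℝ) (T : (Fin d → ℝ) →ₗ[ℝ] (Fin d → ℝ)) :
    (fun y => f (c + T y)) ∈ polySpace d n := by
  obtain ⟨P, hP, h⟩ := hf
  refine ⟨MvPolynomial.bind₁ (fun i => MvPolynomial.C (c i) +
    ∑ j, MvPolynomial.C (T (Pi.single j 1) i) * MvPolynomial.X j) P, ?_, fun y => ?_⟩
  · refine (MvPolynomial.totalDegree_bind₁_le P hP _ (k := 1) fun i => ?_).trans (by simp)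
    refine (MvPolynomial.totalDegree_add _ _).trans (max_le (by simp) ?_)
    refine MvPolynomial.totalDegree_finsetSum_le fun j _ => ?_
    refine (MvPolynomial.totalDegree_mul _ _).trans (by simp)
  · change f (c + T y) = _
    rw [h, MvPolynomial.eval, MvPolynomial.eval, MvPolynomial.eval₂Hom_bind₁]
    congr 2
    funext i
    have : T y = ∑ j, y j • T (Pi.single j 1) := by
      conv_lhs => rw [pi_eq_sum_univ' y]
      simp only [map_sum, map_smul]
    simp [this, mul_comm]

theorem polySpace_comp_curve {d n k : ℕ} {f : (Fin d → ℝ) → ℝ} (hf : f ∈ polySpace d n)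
    (p : Fin d → Polynomial ℝ) (hp : ∀ i, (p i).natDegree ≤ k) :
    ∃ q : Polynomial ℝ, q.natDegree ≤ n * k ∧ ∀ t, q.eval t = f (fun i => (p i).eval t) := by
  obtain ⟨P, hP, h⟩ := hf
  refine ⟨MvPolynomial.aeval p P, MvPolynomial.aeval_natDegree_le P hP p hp, fun t => ?_⟩
  rw [h, ← Polynomial.coe_evalRingHom, MvPolynomial.map_aeval]
  rw [MvPolynomial.eval]
  congr 2
  ext
  simp

/-! ### Parabolas from a maximum point: the estimate on the Euclidean ball. -/

theorem exists_unit_vector {d : ℕ} (hd : 0 < d) (z : Fin d → ℝ) :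
    ∃ (e : Fin d → ℝ) (ρ : ℝ), e ⬝ᵥ e = 1 ∧ 0 ≤ ρ ∧ z = ρ • e := by
  by_cases hz : z = 0
  · exact ⟨Pi.single ⟨0, hd⟩ 1, 0, by simp, le_rfl, by simp [hz]⟩
  · have h1 : 0 < z ⬝ᵥ z := lt_of_le_of_ne (Finset.sum_nonneg fun i _ => mul_self_nonneg (z i))
      (fun h => hz (dotProduct_self_eq_zero.1 h.symm))
    have h2 := Real.sqrt_pos.2 h1
    refine ⟨(Real.sqrt (z ⬝ᵥ z))⁻¹ • z, Real.sqrt (z ⬝ᵥ z), ?_, h2.le, ?_⟩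
    · rw [smul_dotProduct, dotProduct_smul, smul_eq_mul, smul_eq_mul, ← mul_assoc, ← mul_inv,
        Real.mul_self_sqrt h1.le, inv_mul_cancel₀ h1.ne']
    · rw [smul_smul, mul_inv_cancel₀ h2.ne', one_smul]

theorem isCompact_dotProduct_self_le (d : ℕ) (r : ℝ) :
    IsCompact {x : Fin d → ℝ | x ⬝ᵥ x ≤ r} := by
  refine (isCompact_univ_pi fun _ : Fin d =>
    isCompact_Icc (a := -Real.sqrt r) (b := Real.sqrt r)).of_isClosed_subset
    (isClosed_le (by unfold dotProduct; fun_prop) continuous_const) fun x hx i _ => ?_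
  have : x i ^ 2 ≤ r := by
    refine le_trans ?_ hx
    rw [dotProduct, sq]
    exact Finset.single_le_sum (f := fun i => x i * x i) (fun i _ => mul_self_nonneg _)
      (Finset.mem_univ i)
  exact abs_le.1 (Real.abs_le_sqrt this)

/-- The linear map contracting by `ε²` in the direction of `e` and by `ε` orthogonally to it. -/
noncomputable def parabolicScaling {d : ℕ} (e : Fin d → ℝ) (ε : ℝ) :
    (Fin d → ℝ) →ₗ[ℝ] (Fin d → ℝ) :=
  Matrix.toLin' (ε • (1 + Matrix.replicateCol Unit ((ε - 1) • e) * Matrix.replicateRow Unit e))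

theorem parabolicScaling_apply {d : ℕ} (e : Fin d → ℝ) (ε : ℝ) (u : Fin d → ℝ) :
    parabolicScaling e ε u = ε • u + (ε * (ε - 1) * (e ⬝ᵥ u)) • e := by
  rw [parabolicScaling, Matrix.toLin'_apply, Matrix.smul_mulVec, Matrix.add_mulVec,
    Matrix.one_mulVec, ← Matrix.mulVec_mulVec]
  ext i
  simp only [Matrix.mulVec, Matrix.replicateCol_apply, Matrix.replicateRow_apply, dotProduct,
    Pi.smul_apply, Pi.add_apply, smul_eq_mul, Finset.univ_unique, Finset.sum_singleton]
  ring

/-- One factor `ε²` along `e` and `d - 1` factors `ε` across it: with `ε` of order `1/n` this is the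
source of the exponent `d + 1`. -/
theorem det_parabolicScaling {d : ℕ} {e : Fin d → ℝ} (he : e ⬝ᵥ e = 1) (ε : ℝ) :
    LinearMap.det (parabolicScaling e ε) = ε ^ (d + 1) := by
  rw [parabolicScaling, LinearMap.det_toLin', Matrix.det_smul,
    Matrix.det_one_add_replicateCol_mul_replicateRow, dotProduct_smul, he]
  simp [pow_succ]

theorem dotProduct_self_smul_add_smul {d : ℕ} {e w : Fin d → ℝ} (he : e ⬝ᵥ e = 1)
    (hw : e ⬝ᵥ w = 0) (a b : ℝ) :
    (a • e + b • w) ⬝ᵥ (a • e + b • w) = a ^ 2 + b ^ 2 * (w ⬝ᵥ w) := by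
  simp only [add_dotProduct, dotProduct_add, smul_dotProduct, dotProduct_smul, smul_eq_mul, he,
    hw, dotProduct_comm w e]
  ring

/-- If `|f|` attains its maximum over a ball of radius at least `1` at `ρ e`, then `|f|` remains
large along parabolas with vertex at `ρ e` and axis `-e`. -/
theorem polySpace_half_le_on_parabola {d n : ℕ} (hn : 1 ≤ n) {f : (Fin d → ℝ) → ℝ}
    (hf : f ∈ polySpace d n) {R ρ : ℝ} (hR : 1 ≤ R) (hρ : 0 ≤ ρ) (hρR : ρ ^ 2 ≤ R)
    {e ξ : Fin d → ℝ} (he : e ⬝ᵥ e = 1) (heξ : e ⬝ᵥ ξ = 0) (hξ : ξ ⬝ᵥ ξ ≤ 1 / 4)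
    (hmax : ∀ x : Fin d → ℝ, x ⬝ᵥ x ≤ R → |f x| ≤ |f (ρ • e)|)
    {t : ℝ} (ht : t ^ 2 ≤ (1 / (4 * n)) ^ 2) :
    |f (ρ • e)| ≤ 2 * |f ((ρ - t ^ 2 / 2) • e + t • ξ)| := by
  rcases (abs_nonneg (f (ρ • e))).eq_or_lt with hM | hM
  · rw [← hM]; positivity
  obtain ⟨s, hs, hsz⟩ : ∃ s : ℝ, |s| = 1 ∧ s * f (ρ • e) = |f (ρ • e)| := by
    rcases le_total 0 (f (ρ • e)) with h | h
    · exact ⟨1, by simp, by rw [abs_of_nonneg h, one_mul]⟩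
    · exact ⟨-1, by simp, by rw [abs_of_nonpos h, neg_one_mul]⟩
  obtain ⟨q, hqdeg, hq⟩ := polySpace_comp_curve (k := 2) hf (fun i => Polynomial.C (ρ * e i) -
      Polynomial.C (e i / 2) * Polynomial.X ^ 2 + Polynomial.C (ξ i) * Polynomial.X)
    (fun i => by compute_degree)
  have hcurve : ∀ t : ℝ, q.eval t = f ((ρ - t ^ 2 / 2) • e + t • ξ) := by
    intro t
    rw [hq]
    congr 1
    ext i
    simp
    ring
  have hbd : ∀ t ∈ Set.Icc (-1 : ℝ) 1, |(Polynomial.C s * q).eval t| ≤ |f (ρ • e)| := by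
    intro t ht
    rw [Polynomial.eval_mul, Polynomial.eval_C, abs_mul, hs, one_mul, hcurve]
    apply hmax
    rw [dotProduct_self_smul_add_smul he heξ]
    have ht2 : t ^ 2 ≤ 1 := (sq_le_one_iff_abs_le_one t).2 (abs_le.2 ht)
    have h6 : t ^ 2 * (ξ ⬝ᵥ ξ) ≤ t ^ 2 * (1 / 4) := by gcongr
    have h7 : t ^ 2 * t ^ 2 ≤ t ^ 2 * 1 := by gcongr
    have e2 : (ρ - t ^ 2 / 2) ^ 2 = ρ ^ 2 - t ^ 2 * ρ + t ^ 2 * t ^ 2 / 4 := by ring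
    rw [e2]
    -- The parabola must stay in the ball where the maximum was taken. For `ρ ≥ 1/2` the descent
    -- `-t²ρ` pays for the sideways and quartic terms; for `ρ ≤ 1/2` the point is well inside.
    rcases le_total (1 / 2) ρ with hρ2 | hρ2
    · have h8 : t ^ 2 * (1 / 2) ≤ t ^ 2 * ρ := by gcongr
      linarith
    · have h8 : 0 ≤ t ^ 2 * ρ := by positivity
      have h9 : ρ ^ 2 ≤ (1 / 2) ^ 2 := by gcongr
      linarith
  have hfin := Polynomial.half_le_eval_of_isMax hn (p := Polynomial.C s * q) hM
    ((Polynomial.natDegree_C_mul_le _ _).trans (by omega)) hbd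
    (by rw [Polynomial.eval_mul, Polynomial.eval_C, hcurve, ← hsz]; simp) ht
  rw [Polynomial.eval_mul, Polynomial.eval_C, hcurve] at hfin
  have := le_abs_self (s * f ((ρ - t ^ 2 / 2) • e + t • ξ))
  rw [abs_mul, hs, one_mul] at this
  linarith

/-- A polynomial of degree at most `n` is at least half as large as at a given point (near to) the
unit ball on a subset of the unit ball of volume at least a constant times `n^{-(d+1)}`. -/
theorem polySpace_exists_large_set {d n : ℕ} (hd : 0 < d) (hn : 1 ≤ n) {f : (Fin d → ℝ) → ℝ}
    (hf : f ∈ polySpace d n) {y : Fin d → ℝ} (hy : y ⬝ᵥ y ≤ 1 + 1 / (100 * n ^ 2)) :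
    ∃ A : Set (Fin d → ℝ), A ⊆ {x | x ⬝ᵥ x ≤ 1} ∧
      ENNReal.ofReal ((1 / (4 * n)) ^ (d + 1) * (1 / (4 * d)) ^ d) ≤ volume A ∧
      ∀ a ∈ A, |f y| ≤ 2 * |f a| := by
  have hn' : (1 : ℝ) ≤ n := by exact_mod_cast hn
  have hd' : (1 : ℝ) ≤ d := by exact_mod_cast hd
  set R : ℝ := 1 + 1 / (100 * n ^ 2) with hR
  have hR1 : 1 ≤ R := by
    rw [hR]
    have : (0 : ℝ) ≤ 1 / (100 * n ^ 2) := by positivity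
    linarith
  obtain ⟨z, hzK, hzmax⟩ := (isCompact_dotProduct_self_le d R).exists_isMaxOn ⟨y, hy⟩
    (polySpace_continuous hf).abs.continuousOn
  have hzmax' : ∀ x : Fin d → ℝ, x ⬝ᵥ x ≤ R → |f x| ≤ |f z| := fun x hx => hzmax hx
  obtain ⟨e, ρ, he, hρ, hze⟩ := exists_unit_vector hd z
  have hρR : ρ ^ 2 ≤ R := by
    have : z ⬝ᵥ z ≤ R := hzK
    rw [hze, smul_dotProduct, dotProduct_smul, he] at this
    simpa [sq] using this
  set ε : ℝ := 1 / (4 * n) with hε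
  have hε0 : 0 < ε := by positivity
  have hε2 : ε ^ 2 ≤ 1 / 16 := by
    rw [hε, div_pow, mul_pow]
    apply div_le_div₀ <;> nlinarith
  have hRε : R = 1 + 4 / 25 * ε ^ 2 := by
    rw [hR, hε]; field_simp; ring
  have hnorm := fun a b w hw => dotProduct_self_smul_add_smul (w := w) he hw a b
  -- These balls are sup-norm cubes, whose volume is explicit. The radius `1/(8d)` puts `u` within
  -- Euclidean distance `1/8` of `-(3/8)e`, so its `e`-component `β` lies in `[-1/2, -1/4]` and its
  -- transverse part `w` has length at most `1/8`.
  have hdec : ∀ u ∈ Metric.closedBall (-(3 / 8 : ℝ) • e) (1 / (8 * d)),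
      ∃ (w : Fin d → ℝ) (β : ℝ), e ⬝ᵥ w = 0 ∧ (β + 3 / 8) ^ 2 + w ⬝ᵥ w ≤ 1 / 64 ∧
        z + parabolicScaling e ε u = (ρ + ε ^ 2 * β) • e + ε • w := by
    intro u hu
    have hew : e ⬝ᵥ (u - (e ⬝ᵥ u) • e) = 0 := by
      rw [dotProduct_sub, dotProduct_smul, he]; simp
    refine ⟨u - (e ⬝ᵥ u) • e, e ⬝ᵥ u, hew, ?_, ?_⟩
    · have h1 := hnorm (e ⬝ᵥ u + 3 / 8) 1 _ hew
      rw [one_pow, one_mul] at h1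
      rw [← h1]
      have h2 : (e ⬝ᵥ u + 3 / 8) • e + (1 : ℝ) • (u - (e ⬝ᵥ u) • e) = u + (3 / 8 : ℝ) • e := by
        module
      rw [h2]
      have h3 : ∀ i, (u + (3 / 8 : ℝ) • e) i * (u + (3 / 8 : ℝ) • e) i ≤ (1 / (8 * d)) ^ 2 := by
        intro i
        rw [mem_closedBall_iff_norm, neg_smul, sub_neg_eq_add] at hu
        have := (norm_le_pi_norm (u + (3 / 8 : ℝ) • e) i).trans hu
        rw [Real.norm_eq_abs] at this
        rw [← sq]
        exact sq_le_sq' (abs_le.1 this).1 (abs_le.1 this).2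
      refine (Finset.sum_le_sum fun i _ => h3 i).trans ?_
      rw [Finset.sum_const, Finset.card_univ, Fintype.card_fin, nsmul_eq_mul]
      rw [show (d : ℝ) * (1 / (8 * d)) ^ 2 = 1 / (64 * d) by field_simp; norm_num]
      apply one_div_le_one_div_of_le <;> linarith
    · rw [parabolicScaling_apply, hze]
      module
  refine ⟨(fun u => z + parabolicScaling e ε u) ''
    Metric.closedBall (-(3 / 8 : ℝ) • e) (1 / (8 * d)), ?_, ?_, ?_⟩
  · rintro _ ⟨u, hu, rfl⟩
    obtain ⟨w, β, hew, hw, hval⟩ := hdec u hu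
    have hw0 : 0 ≤ w ⬝ᵥ w := Finset.sum_nonneg fun i _ => mul_self_nonneg (w i)
    have hβ := abs_le.1 (Real.abs_le_sqrt (by linarith : (β + 3 / 8) ^ 2 ≤ 1 / 64))
    rw [show (1 / 64 : ℝ) = (1 / 8) ^ 2 by norm_num, Real.sqrt_sq (by norm_num)] at hβ
    have hw64 : w ⬝ᵥ w ≤ 1 / 64 := by nlinarith
    change (z + parabolicScaling e ε u) ⬝ᵥ (z + parabolicScaling e ε u) ≤ 1
    rw [hval, hnorm _ _ w hew]
    have h1 : ε ^ 2 * (w ⬝ᵥ w) ≤ ε ^ 2 * (1 / 64) := by gcongr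
    have h2 : β ^ 2 ≤ 1 / 4 := by nlinarith
    have h3 : ε ^ 2 * ε ^ 2 * β ^ 2 ≤ ε ^ 2 * (1 / 64) := by
      rw [mul_assoc]
      gcongr
      calc ε ^ 2 * β ^ 2 ≤ 1 / 16 * (1 / 4) := by gcongr
        _ = 1 / 64 := by norm_num
    have e1 : (ρ + ε ^ 2 * β) ^ 2 = ρ ^ 2 + ε ^ 2 * (2 * ρ * β) + ε ^ 2 * ε ^ 2 * β ^ 2 := by ring
    rw [e1]
    -- For `ρ ≥ 1/2` the inward move gains at least `ε²/4`, more than the excess `R - 1 = (4/25)ε²`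
    -- plus the errors `ε²/64 + ε²/64`. This is why the constant 100 brings the set back into the
    -- unit ball even if `z` lies outside it.
    rcases le_total (1 / 2) ρ with hρ2 | hρ2
    · have h4 : ε ^ 2 * (2 * ρ * β) ≤ ε ^ 2 * (-(1 / 4)) := by
        gcongr
        nlinarith
      linarith [sq_nonneg ε]
    · have h4 : ε ^ 2 * (2 * ρ * β) ≤ ε ^ 2 * 0 := by
        gcongr
        nlinarith
      nlinarith
  · have : (fun u => z + parabolicScaling e ε u) '' Metric.closedBall (-(3 / 8 : ℝ) • e) (1 / (8 * d))
        = (fun x => z + x) '' (parabolicScaling e ε ''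
          Metric.closedBall (-(3 / 8 : ℝ) • e) (1 / (8 * d))) := by
      rw [Set.image_image]
    rw [this, Set.image_add_left, measure_preimage_add, Measure.addHaar_image_linearMap,
      det_parabolicScaling he, Real.volume_pi_closedBall _ (by positivity),
      abs_of_pos (by positivity), Fintype.card_fin, ← ENNReal.ofReal_mul (by positivity)]
    refine ENNReal.ofReal_le_ofReal (le_of_eq ?_)
    congr 2
    field_simp
    norm_num
  · rintro _ ⟨u, hu, rfl⟩
    obtain ⟨w, β, hew, hw, hval⟩ := hdec u hu
    have hw0 : 0 ≤ w ⬝ᵥ w := Finset.sum_nonneg fun i _ => mul_self_nonneg (w i)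
    have hβ := abs_le.1 (Real.abs_le_sqrt (by linarith : (β + 3 / 8) ^ 2 ≤ 1 / 64))
    rw [show (1 / 64 : ℝ) = (1 / 8) ^ 2 by norm_num, Real.sqrt_sq (by norm_num)] at hβ
    have hw64 : w ⬝ᵥ w ≤ 1 / 64 := by nlinarith
    refine (hzmax' y hy).trans ?_
    have hγ : 0 < -2 * β := by linarith
    -- The point lies on the parabola with direction `ξ = w/γ` at parameter `t = εγ`, since then
    -- `-t²/2 = ε²β` and `tξ = εw`; the range of `β` gives `1/2 ≤ γ² ≤ 1`.
    set γ : ℝ := Real.sqrt (-2 * β) with hγdef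
    have hγ0 : 0 < γ := Real.sqrt_pos.2 hγ
    have hγ2 : γ ^ 2 = -2 * β := Real.sq_sqrt hγ.le
    have hfin := polySpace_half_le_on_parabola hn hf (ξ := γ⁻¹ • w) (t := ε * γ) hR1 hρ hρR he
      (by rw [dotProduct_smul, hew, smul_zero])
      (by
        rw [smul_dotProduct, dotProduct_smul, smul_eq_mul, smul_eq_mul, ← mul_assoc, ← mul_inv,
          ← sq, hγ2, inv_mul_le_iff₀ hγ]
        linarith)
      (by rw [← hze]; exact hzmax')
      (by
        rw [mul_pow, hγ2]
        exact mul_le_of_le_one_right (sq_nonneg _) (by linarith))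
    have hpt : (ρ - (ε * γ) ^ 2 / 2) • e + (ε * γ) • γ⁻¹ • w = z + parabolicScaling e ε u := by
      rw [hval, smul_smul, mul_pow, hγ2, mul_inv_cancel_right₀ hγ0.ne']
      module
    rw [hpt, ← hze] at hfin
    exact hfin

/-! ### Christoffel function and norm quotient as extremal constants. -/

theorem ApproxPow.of_ofReal_bounds {a : ℕ → ℝ≥0∞} {s c₁ c₂ : ℝ} (h₁ : 0 < c₁) (h₂ : 0 < c₂)
    (hlow : ∀ n : ℕ, 1 ≤ n → ENNReal.ofReal (c₁ * (n : ℝ) ^ s) ≤ a n)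
    (hup : ∀ n : ℕ, 1 ≤ n → a n ≤ ENNReal.ofReal (c₂ * (n : ℝ) ^ s)) : ApproxPow a s := by
  refine ⟨(max c₁⁻¹ c₂).toNNReal, Real.toNNReal_pos.2 (lt_max_of_lt_right h₂), fun n hn => ?_⟩
  have hn0 : (0 : ℝ) < n := by exact_mod_cast hn
  have hpow : (n : ℝ≥0∞) ^ s = ENNReal.ofReal ((n : ℝ) ^ s) := by
    rw [← ENNReal.ofReal_rpow_of_pos hn0, ENNReal.ofReal_natCast]
  have hc : (0 : ℝ) < max c₁⁻¹ c₂ := lt_max_of_lt_right h₂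
  rw [hpow]
  constructor
  · refine le_trans ?_ (hlow n hn)
    rw [← Real.toNNReal_inv]
    change ENNReal.ofReal _ * _ ≤ _
    rw [← ENNReal.ofReal_mul (inv_nonneg.2 hc.le)]
    apply ENNReal.ofReal_le_ofReal
    gcongr
    exact inv_le_of_inv_le₀ h₁ (le_max_left _ _)
  · refine (hup n hn).trans ?_
    change _ ≤ ENNReal.ofReal _ * _
    rw [← ENNReal.ofReal_mul hc.le]
    apply ENNReal.ofReal_le_ofReal
    gcongr
    exact le_max_right _ _

theorem IsOrthonormalBasisFor.integral_sum_sq {X ι : Type*} [MeasurableSpace X] [DecidableEq ι]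
    [Fintype ι] {S : Submodule ℝ (X → ℝ)} {μ : Measure X} {φ : ι → X → ℝ}
    (h : IsOrthonormalBasisFor S μ φ) (a : ι → ℝ) :
    ∫ x, (∑ i, a i * φ i x) ^ 2 ∂μ = ∑ i, a i ^ 2 := by
  have hint : ∀ i j, Integrable (fun x => (a i * a j) * (φ i x * φ j x)) μ := fun i j =>
    ((h.memLp i).integrable_mul (h.memLp j)).const_mul _
  calc ∫ x, (∑ i, a i * φ i x) ^ 2 ∂μ
      = ∫ x, ∑ i, ∑ j, (a i * a j) * (φ i x * φ j x) ∂μ := by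
        congr 1
        ext x
        rw [sq, Finset.sum_mul_sum]
        exact Finset.sum_congr rfl fun i _ => Finset.sum_congr rfl fun j _ => by ring
    _ = ∑ i, ∑ j, (a i * a j) * ∫ x, φ i x * φ j x ∂μ := by
        rw [integral_finsetSum _ fun i _ => integrable_finsetSum _ fun j _ => hint i j]
        refine Finset.sum_congr rfl fun i _ => ?_
        rw [integral_finsetSum _ fun j _ => hint i j]
        exact Finset.sum_congr rfl fun j _ => integral_const_mul _ _
    _ = ∑ i, a i ^ 2 := by simp [h.integral_mul, sq]

/-- Test the inequality on the reproducing kernel `f = ∑ φᵢ(x) φᵢ` at `x`: both `f(x)` and `∫ f²`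
equal `∑ φᵢ(x)²`. -/
theorem IsOrthonormalBasisFor.christoffelInv_le {X : Type*} [MeasurableSpace X] {N : ℕ}
    {S : Submodule ℝ (X → ℝ)} {μ : Measure X} {φ : Fin N → X → ℝ}
    (h : IsOrthonormalBasisFor S μ φ) {x : X} {K : ℝ} (hK : 0 ≤ K)
    (hS : ∀ f ∈ S, f x ^ 2 ≤ K * ∫ y, f y ^ 2 ∂μ) : christoffelInv S μ x ≤ K := by
  rw [h.christoffelInv_eq]
  have mφ : ∀ i, φ i ∈ S := fun i => h.span_eq ▸ Submodule.subset_span ⟨i, rfl⟩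
  have h1 := hS (∑ i, φ i x • φ i) (S.sum_mem fun i _ => S.smul_mem _ (mφ i))
  simp only [Finset.sum_apply, Pi.smul_apply, smul_eq_mul] at h1
  rw [h.integral_sum_sq] at h1
  simp only [← sq] at h1
  have h0 : 0 ≤ ∑ i, φ i x ^ 2 := Finset.sum_nonneg fun i _ => sq_nonneg _
  rcases h0.eq_or_lt with h0 | h0
  · rwa [← h0]
  · rw [sq] at h1
    exact le_of_mul_le_mul_right h1 h0

/-- Cauchy–Schwarz for the expansion of `f`, with Parseval for its coefficients. -/
theorem IsOrthonormalBasisFor.sq_le_christoffelInv_mul {X : Type*} [MeasurableSpace X] {N : ℕ}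
    {S : Submodule ℝ (X → ℝ)} {μ : Measure X} {φ : Fin N → X → ℝ}
    (h : IsOrthonormalBasisFor S μ φ) {f : X → ℝ} (hf : f ∈ S) (x : X) :
    f x ^ 2 ≤ christoffelInv S μ x * ∫ y, f y ^ 2 ∂μ := by
  have h1 : ∫ y, f y ^ 2 ∂μ = ∑ i, (∫ y, f y * φ i y ∂μ) ^ 2 := by
    rw [← h.integral_sum_sq]
    congr 1
    ext y
    rw [← h.eq_sum hf y]
  rw [h1, h.christoffelInv_eq, h.eq_sum hf x, mul_comm]
  exact Finset.sum_mul_sq_le_sq_mul_sq _ _ _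

/-- Definiteness on `S` makes the `L²` pairing an inner product on the functions themselves, without
passing to almost-everywhere classes. -/
theorem exists_isOrthonormalBasisFor {X : Type*} [MeasurableSpace X] {μ : Measure X}
    (S : Submodule ℝ (X → ℝ)) [FiniteDimensional ℝ S] (hL : ∀ f ∈ S, MemLp f 2 μ)
    (hdef : ∀ f ∈ S, ∫ x, f x ^ 2 ∂μ = 0 → f = 0) :
    ∃ (N : ℕ) (φ : Fin N → X → ℝ), IsOrthonormalBasisFor S μ φ := by
  have hint : ∀ f g : S, Integrable (fun x => (f : X → ℝ) x * (g : X → ℝ) x) μ := fun f g =>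
    (hL f f.2).integrable_mul (hL g g.2)
  let core : InnerProductSpace.Core ℝ S :=
    { inner := fun f g => ∫ x, (f : X → ℝ) x * (g : X → ℝ) x ∂μ
      conj_inner_symm := fun f g => by
        change ∫ x, (g : X → ℝ) x * (f : X → ℝ) x ∂μ = ∫ x, (f : X → ℝ) x * (g : X → ℝ) x ∂μ
        simp only [mul_comm]
      re_inner_nonneg := fun f => integral_nonneg fun x => mul_self_nonneg _
      add_left := fun f g k => by
        change ∫ x, ((f : X → ℝ) x + (g : X → ℝ) x) * (k : X → ℝ) x ∂μ = _
        simp only [add_mul]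
        exact integral_add (hint f k) (hint g k)
      smul_left := fun f g r => by
        change ∫ x, (r * (f : X → ℝ) x) * (g : X → ℝ) x ∂μ = r * _
        simp only [mul_assoc]
        exact integral_const_mul _ _
      definite := fun f hf => Subtype.ext (hdef f f.2 (by
        rw [← hf]
        simp only [sq])) }
  let _ : NormedAddCommGroup S := core.toNormedAddCommGroup
  let _ : InnerProductSpace ℝ S := InnerProductSpace.ofCore core.toCore
  let b := stdOrthonormalBasis ℝ S
  refine ⟨_, fun i => (b i : X → ℝ), fun i => hL _ (b i).2, fun i j => ?_, ?_⟩
  · exact orthonormal_iff_ite.1 b.orthonormal i j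
  · have h := congrArg (Submodule.map S.subtype) b.toBasis.span_eq
    rw [Submodule.map_span, Submodule.map_subtype_top, ← Set.range_comp] at h
    refine Eq.trans ?_ h
    congr 2

instance polySpace_finiteDimensional (d n : ℕ) : FiniteDimensional ℝ (polySpace d n) := by
  let ev : MvPolynomial (Fin d) ℝ →ₗ[ℝ] ((Fin d → ℝ) → ℝ) :=
    { toFun := fun P x => MvPolynomial.eval x P
      map_add' := fun P Q => by ext x; simp
      map_smul' := fun r P => by ext x; simp [MvPolynomial.smul_eval] }
  have h : polySpace d n = (MvPolynomial.restrictTotalDegree (Fin d) ℝ n).map ev := by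
    ext f
    constructor
    · rintro ⟨P, hP, h⟩
      exact ⟨P, (MvPolynomial.mem_restrictTotalDegree _ _ _).2 hP, (funext h).symm⟩
    · rintro ⟨P, hP, rfl⟩
      exact ⟨P, (MvPolynomial.mem_restrictTotalDegree _ _ _).1 hP, fun x => rfl⟩
  rw [h]
  infer_instance

theorem polySpace_memLp {d n : ℕ} {f : (Fin d → ℝ) → ℝ} (hf : f ∈ polySpace d n)
    {D : Set (Fin d → ℝ)} (hD : IsCompact D) : MemLp f 2 (volume.restrict D) := by
  have hc := polySpace_continuous hf
  rw [memLp_two_iff_integrable_sq hc.aestronglyMeasurable]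
  exact (hc.pow 2).continuousOn.integrableOn_compact hD

theorem polySpace_eq_zero_of_eqOn {d n : ℕ} {f : (Fin d → ℝ) → ℝ} (hf : f ∈ polySpace d n)
    {U : Set (Fin d → ℝ)} (hU : IsOpen U) (hne : U.Nonempty) (h0 : Set.EqOn f 0 U) : f = 0 := by
  obtain ⟨P, -, h⟩ := hf
  obtain ⟨u, hu⟩ := hne
  obtain ⟨ε, hε, hball⟩ := Metric.isOpen_iff.1 hU u hu
  have : P = 0 := by
    refine MvPolynomial.funext_set (s := fun i => Set.Ioo (u i - ε) (u i + ε))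
      (fun i => Set.Ioo_infinite (by linarith)) fun x hx => ?_
    rw [← h x, map_zero]
    apply h0
    apply hball
    rw [Metric.mem_ball, dist_pi_lt_iff hε]
    intro i
    have := hx i (Set.mem_univ i)
    rw [Real.dist_eq, abs_lt]
    constructor <;> linarith [this.1, this.2]
  ext x
  rw [h, this, map_zero, Pi.zero_apply]

theorem polySpace_eq_zero_of_integral_sq {d n : ℕ} {f : (Fin d → ℝ) → ℝ}
    (hf : f ∈ polySpace d n) {D : Set (Fin d → ℝ)} (hD : IsCompact D)
    (hne : (interior D).Nonempty) (h : ∫ x in D, f x ^ 2 = 0) : f = 0 := by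
  have hc := polySpace_continuous hf
  rw [integral_eq_zero_iff_of_nonneg (fun x => sq_nonneg (f x))
    ((hc.pow 2).continuousOn.integrableOn_compact hD)] at h
  have h2 : f =ᵐ[volume.restrict (interior D)] 0 := by
    filter_upwards [ae_restrict_of_ae_restrict_of_subset interior_subset h] with x hx
    simpa using hx
  exact polySpace_eq_zero_of_eqOn hf isOpen_interior hne
    (Measure.eqOn_open_of_ae_eq h2 isOpen_interior hc.continuousOn continuousOn_const)

theorem polySpace_eLpNorm_two {d n : ℕ} {f : (Fin d → ℝ) → ℝ} (hf : f ∈ polySpace d n)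
    {D : Set (Fin d → ℝ)} (hD : IsCompact D) :
    eLpNorm f 2 (volume.restrict D) = ENNReal.ofReal (Real.sqrt (∫ x in D, f x ^ 2)) := by
  rw [(polySpace_memLp hf hD).eLpNorm_eq_integral_rpow_norm two_ne_zero ENNReal.ofNat_ne_top,
    Real.sqrt_eq_rpow]
  simp

/-- The essential supremum ignores null sets. If it were below `|f x|`, it would be exceeded on an
open neighbourhood of `x`, which meets the interior of `D` in positive measure. -/
theorem ofReal_abs_le_eLpNorm_top {d : ℕ} {f : (Fin d → ℝ) → ℝ} (hf : Continuous f)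
    {D : Set (Fin d → ℝ)} {x : Fin d → ℝ} (hx : x ∈ closure (interior D)) :
    ENNReal.ofReal |f x| ≤ eLpNorm f ∞ (volume.restrict D) := by
  by_contra! hlt
  rw [← Real.norm_eq_abs, ofReal_norm, eLpNorm_exponent_top] at hlt
  have hopen : IsOpen {y | eLpNormEssSup f (volume.restrict D) < ‖f y‖ₑ} :=
    isOpen_lt continuous_const hf.enorm
  have hne := mem_closure_iff.1 hx _ hopen hlt
  have hpos := (hopen.inter isOpen_interior).measure_pos volume hne
  have hae : ∀ᵐ y ∂(volume.restrict D), ‖f y‖ₑ ≤ eLpNormEssSup f (volume.restrict D) :=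
    enorm_ae_le_eLpNormEssSup f _
  have hzero := ae_restrict_of_ae_restrict_of_subset (interior_subset (s := D)) hae
  rw [ae_restrict_iff' isOpen_interior.measurableSet, ae_iff] at hzero
  refine hpos.ne' (measure_mono_null ?_ hzero)
  rintro y ⟨hy1, hy2⟩ hy
  exact absurd (hy hy2) (not_le.2 hy1)

/-- Two-sided bounds for the Christoffel function and the Nikolskii constant from an upper bound
for all polynomials and one family of extremal polynomials. -/
theorem approxPow_christoffelSup_nikolskiiSup {d : ℕ} {D : Set (Fin d → ℝ)} {σ κ₁ κ₂ : ℝ}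
    (hD : IsCompact D) (hne : (interior D).Nonempty) {x₀ : Fin d → ℝ} (hx₀ : x₀ ∈ D)
    (hx₀' : x₀ ∈ closure (interior D)) (hκ₁ : 0 < κ₁) (hκ₂ : 0 < κ₂)
    (hup : ∀ n : ℕ, 1 ≤ n → ∀ f ∈ polySpace d n, ∀ x ∈ D,
      f x ^ 2 ≤ κ₁ * (n : ℝ) ^ σ * ∫ y in D, f y ^ 2)
    (hlow : ∀ n : ℕ, 1 ≤ n → ∃ f ∈ polySpace d n, f x₀ = 1 ∧
      (∫ y in D, f y ^ 2) * (n : ℝ) ^ σ ≤ κ₂) :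
    ApproxPow (christoffelSup D) σ ∧ ApproxPow (nikolskiiSup D) (σ / 2) := by
  have hpow : ∀ n : ℕ, 1 ≤ n → 0 < (n : ℝ) ^ σ := fun n hn =>
    Real.rpow_pos_of_pos (by exact_mod_cast hn) _
  have hbasis : ∀ n, ∃ (N : ℕ) (φ : Fin N → (Fin d → ℝ) → ℝ),
      IsOrthonormalBasisFor (polySpace d n) (volume.restrict D) φ := fun n =>
    exists_isOrthonormalBasisFor _ (fun f hf => polySpace_memLp hf hD)
      (fun f hf h => polySpace_eq_zero_of_integral_sq hf hD hne h)
  constructor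
  · refine ApproxPow.of_ofReal_bounds (inv_pos.2 hκ₂) hκ₁ (fun n hn => ?_) (fun n hn => ?_)
    · obtain ⟨N, φ, hφ⟩ := hbasis n
      obtain ⟨f, hf, hf1, hfint⟩ := hlow n hn
      refine le_iSup₂_of_le x₀ hx₀ (ENNReal.ofReal_le_ofReal ?_)
      have h1 := hφ.sq_le_christoffelInv_mul hf x₀
      rw [hf1, one_pow] at h1
      have hI : 0 ≤ ∫ y in D, f y ^ 2 := integral_nonneg fun y => sq_nonneg _
      have hC : 0 ≤ christoffelInv (polySpace d n) (volume.restrict D) x₀ := by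
        rw [hφ.christoffelInv_eq]
        exact Finset.sum_nonneg fun i _ => sq_nonneg _
      rw [inv_mul_le_iff₀ hκ₂]
      calc (n : ℝ) ^ σ ≤ christoffelInv (polySpace d n) (volume.restrict D) x₀ *
            (∫ y in D, f y ^ 2) * (n : ℝ) ^ σ := le_mul_of_one_le_left (hpow n hn).le h1
        _ = ((∫ y in D, f y ^ 2) * (n : ℝ) ^ σ) *
            christoffelInv (polySpace d n) (volume.restrict D) x₀ := by ring
        _ ≤ _ := by gcongr
    · obtain ⟨N, φ, hφ⟩ := hbasis n
      refine iSup₂_le fun x hx => ENNReal.ofReal_le_ofReal ?_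
      exact hφ.christoffelInv_le (mul_pos hκ₁ (hpow n hn)).le fun f hf => hup n hn f hf x hx
  · have hsqrt : ∀ n : ℕ, (n : ℝ) ^ (σ / 2) = Real.sqrt ((n : ℝ) ^ σ) := fun n => by
      rw [Real.sqrt_eq_rpow, ← Real.rpow_mul (Nat.cast_nonneg n), div_eq_mul_one_div]
    refine ApproxPow.of_ofReal_bounds (Real.sqrt_pos.2 (inv_pos.2 hκ₂)) (Real.sqrt_pos.2 hκ₁)
      (fun n hn => ?_) (fun n hn => ?_)
    · obtain ⟨f, hf, hf1, hfint⟩ := hlow n hn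
      have hf0 : f ≠ 0 := by rintro rfl; simp at hf1
      have hI : 0 < ∫ y in D, f y ^ 2 := lt_of_le_of_ne (integral_nonneg fun y => sq_nonneg _)
        fun h => hf0 (polySpace_eq_zero_of_integral_sq hf hD hne h.symm)
      refine le_trans ?_ (le_iSup₂_of_le f ⟨hf, hf0⟩ le_rfl)
      have h1 := ofReal_abs_le_eLpNorm_top (polySpace_continuous hf) hx₀'
      rw [hf1, abs_one] at h1
      rw [polySpace_eLpNorm_two hf hD]
      refine le_trans ?_ (ENNReal.div_le_div_right h1 _)
      rw [← ENNReal.ofReal_div_of_pos (Real.sqrt_pos.2 hI), hsqrt,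
        ← Real.sqrt_mul (inv_pos.2 hκ₂).le]
      apply ENNReal.ofReal_le_ofReal
      rw [one_div, ← Real.sqrt_inv]
      apply Real.sqrt_le_sqrt
      rw [inv_mul_le_iff₀ hκ₂, ← div_eq_mul_inv, le_div_iff₀ hI, mul_comm]
      exact hfint
    · refine iSup₂_le fun f hf => ?_
      refine ENNReal.div_le_of_le_mul ?_
      rw [polySpace_eLpNorm_two hf.1 hD, hsqrt, ← Real.sqrt_mul hκ₁.le,
        ← ENNReal.ofReal_mul (Real.sqrt_nonneg _),
        ← Real.sqrt_mul (mul_pos hκ₁ (hpow n hn)).le, eLpNorm_exponent_top]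
      refine eLpNormEssSup_le_of_ae_bound ?_
      filter_upwards [ae_restrict_mem hD.measurableSet] with x hx
      rw [Real.norm_eq_abs]
      exact Real.abs_le_sqrt (hup n hn f hf.1 x hx)

/-! ### Upper bounds from inscribed ellipsoids. -/

/-- Upper bound for polynomials at points of (or close to) an ellipsoid contained in `D`. -/
theorem polySpace_sq_mul_det_le {d n : ℕ} (hd : 0 < d) (hn : 1 ≤ n) {f : (Fin d → ℝ) → ℝ}
    (hf : f ∈ polySpace d n) {D : Set (Fin d → ℝ)} (hD : IsCompact D) (c : Fin d → ℝ)
    (T : (Fin d → ℝ) →ₗ[ℝ] (Fin d → ℝ)) (hT : ∀ z : Fin d → ℝ, z ⬝ᵥ z ≤ 1 → c + T z ∈ D)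
    {y : Fin d → ℝ} (hy : y ⬝ᵥ y ≤ 1 + 1 / (100 * n ^ 2)) :
    f (c + T y) ^ 2 * (|LinearMap.det T| * ((1 / (4 * n)) ^ (d + 1) * (1 / (4 * d)) ^ d)) ≤
      4 * ∫ x in D, f x ^ 2 := by
  obtain ⟨A, hA, hvol, hfA⟩ := polySpace_exists_large_set hd hn (polySpace_comp_affine hf c T) hy
  have hint : Integrable (fun x => f x ^ 2) (volume.restrict D) :=
    ((polySpace_continuous hf).pow 2).continuousOn.integrableOn_compact hD
  set S : Set (Fin d → ℝ) := (fun x => c + x) '' (T '' A) with hS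
  have hSD : S ⊆ D := by
    rintro _ ⟨_, ⟨a, ha, rfl⟩, rfl⟩
    exact hT a (hA ha)
  have hSvol : ENNReal.ofReal (|LinearMap.det T| *
      ((1 / (4 * n)) ^ (d + 1) * (1 / (4 * d)) ^ d)) ≤ volume.restrict D S := by
    rw [Measure.restrict_eq_self _ hSD, hS, Set.image_add_left, measure_preimage_add,
      Measure.addHaar_image_linearMap, ENNReal.ofReal_mul (abs_nonneg _)]
    gcongr
  -- Chebyshev's inequality at level `f(c + Ty)²/4`, which `f²` reaches on the image of the large
  -- set `A`.
  have h1 := mul_meas_ge_le_lintegral₀ (μ := volume.restrict D)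
    (f := fun x => ENNReal.ofReal (f x ^ 2)) hint.aemeasurable.ennreal_ofReal
    (ENNReal.ofReal (f (c + T y) ^ 2 / 4))
  rw [← ofReal_integral_eq_lintegral_ofReal hint
    (Filter.Eventually.of_forall fun x => sq_nonneg _)] at h1
  have hsub : S ⊆ {x | ENNReal.ofReal (f (c + T y) ^ 2 / 4) ≤ ENNReal.ofReal (f x ^ 2)} := by
    rintro _ ⟨_, ⟨a, ha, rfl⟩, rfl⟩
    apply ENNReal.ofReal_le_ofReal
    have := hfA a ha
    have h2 : |f (c + T y)| ^ 2 ≤ (2 * |f (c + T a)|) ^ 2 := by gcongr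
    rw [mul_pow, sq_abs, sq_abs] at h2
    linarith
  have h2 : ENNReal.ofReal (f (c + T y) ^ 2 / 4 * (|LinearMap.det T| *
      ((1 / (4 * n)) ^ (d + 1) * (1 / (4 * d)) ^ d))) ≤ ENNReal.ofReal (∫ x in D, f x ^ 2) := by
    rw [ENNReal.ofReal_mul (by positivity)]
    refine le_trans ?_ h1
    gcongr
    exact hSvol.trans (measure_mono hsub)
  rw [ENNReal.ofReal_le_ofReal_iff (integral_nonneg fun x => sq_nonneg _)] at h2
  linarith

/-- The upper bound on polynomials over `D` if every point of `D` is almost contained in a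
large ellipsoid inside `D`. -/
theorem polySpace_sq_le_of_ellipsoids {d : ℕ} (hd : 0 < d) {D : Set (Fin d → ℝ)}
    (hD : IsCompact D) {σ κ : ℝ} (hκ : 0 < κ)
    (hell : ∀ n : ℕ, 1 ≤ n → ∀ x ∈ D, ∃ (c y : Fin d → ℝ) (T : (Fin d → ℝ) →ₗ[ℝ] (Fin d → ℝ)),
      (∀ z : Fin d → ℝ, z ⬝ᵥ z ≤ 1 → c + T z ∈ D) ∧ y ⬝ᵥ y ≤ 1 + 1 / (100 * n ^ 2) ∧
      c + T y = x ∧ κ * (n : ℝ) ^ (d + 1 - σ) ≤ |LinearMap.det T|) :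
    ∃ K > 0, ∀ n : ℕ, 1 ≤ n → ∀ f ∈ polySpace d n, ∀ x ∈ D,
      f x ^ 2 ≤ K * (n : ℝ) ^ σ * ∫ y in D, f y ^ 2 := by
  have hd' : (0 : ℝ) < d := by exact_mod_cast hd
  set K : ℝ := 4 / (κ * ((1 / 4) ^ (d + 1) * (1 / (4 * d)) ^ d)) with hK
  refine ⟨K, by positivity, fun n hn f hf x hx => ?_⟩
  have hn0 : (0 : ℝ) < n := by exact_mod_cast hn
  obtain ⟨c, y, T, hT, hy, rfl, hdet⟩ := hell n hn x hx
  have h1 := polySpace_sq_mul_det_le hd hn hf hD c T hT hy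
  have h2 : f (c + T y) ^ 2 * ((κ * (n : ℝ) ^ (d + 1 - σ)) *
      ((1 / (4 * n)) ^ (d + 1) * (1 / (4 * d)) ^ d)) ≤ 4 * ∫ x in D, f x ^ 2 :=
    le_trans (by gcongr) h1
  have h3 : (κ * (n : ℝ) ^ (d + 1 - σ)) * ((1 / (4 * n)) ^ (d + 1) * (1 / (4 * d)) ^ d) =
      4 / (K * (n : ℝ) ^ σ) := by
    have e1 : (n : ℝ) ^ ((d : ℝ) + 1 - σ) = n ^ (d + 1) / (n : ℝ) ^ σ := by
      rw [Real.rpow_sub hn0]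
      congr 1
      exact_mod_cast Real.rpow_natCast (n : ℝ) (d + 1)
    rw [e1, hK, one_div_pow (4 * (n : ℝ)), one_div_pow (4 : ℝ), mul_pow]
    have := Real.rpow_pos_of_pos hn0 σ
    field_simp
  have hpos : 0 < K * (n : ℝ) ^ σ := by positivity
  rw [h3, mul_div_assoc', div_le_iff₀ hpos] at h2
  linarith

/-! ### Lower bounds from small caps. -/

theorem polySpace_mono {d m n : ℕ} (h : m ≤ n) : polySpace d m ≤ polySpace d n := by
  rintro f ⟨P, hP, hf⟩
  exact ⟨P, hP.trans h, hf⟩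

theorem polySpace_eval_coord {d : ℕ} (q : Polynomial ℝ) (i : Fin d) :
    (fun x : Fin d → ℝ => q.eval (x i)) ∈ polySpace d q.natDegree := by
  refine ⟨Polynomial.aeval (MvPolynomial.X i) q, ?_, fun x => ?_⟩
  · rw [Polynomial.aeval_eq_sum_range]
    refine MvPolynomial.totalDegree_finsetSum_le fun j hj => ?_
    refine (MvPolynomial.totalDegree_smul_le _ _).trans ?_
    rw [MvPolynomial.totalDegree_X_pow]
    exact Nat.lt_succ_iff.1 (Finset.mem_range.1 hj)
  · change q.eval (x i) = _
    rw [Polynomial.aeval_eq_sum_range, Polynomial.eval_eq_sum_range]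
    simp [MvPolynomial.smul_eval]

/-- Volume of the cap of height `u` of a body with a cusp-like or conical boundary point. -/
theorem volume_cap_le {d : ℕ} {D : Set (Fin d → ℝ)} (L : (Fin d → ℝ) ≃ₗ[ℝ] (Fin d → ℝ))
    (i₀ : Fin d) (x₀ : Fin d → ℝ) {C γ : ℝ} (hC : 0 < C) (hγ : 0 ≤ γ)
    (hle : ∀ x ∈ D, L x i₀ ≤ 1)
    (hcap : ∀ x ∈ D, ∀ j ≠ i₀, |L x j - L x₀ j| ≤ C * (1 - L x i₀) ^ γ) {u : ℝ} (hu : 0 < u) :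
    volume (D ∩ {x | 1 - L x i₀ ≤ u}) ≤ ENNReal.ofReal
      (|LinearMap.det (L.symm : (Fin d → ℝ) →ₗ[ℝ] (Fin d → ℝ))| * (2 * C) ^ (d - 1) *
        u ^ (1 + γ * ((d : ℝ) - 1))) := by
  have hd : 1 ≤ d := Nat.one_le_of_lt i₀.2
  -- In the coordinates `L` the cap fits in a box with one side `u` and `d - 1` sides `2C u^γ`.
  have hsub : D ∩ {x | 1 - L x i₀ ≤ u} ⊆ L ⁻¹' (Set.univ.pi fun j => if j = i₀ then Set.Icc (1 - u) 1
      else Set.Icc (L x₀ j - C * u ^ γ) (L x₀ j + C * u ^ γ)) := by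
    rintro x ⟨hxD, hxu⟩ j -
    have hxu' : 1 - L x i₀ ≤ u := hxu
    by_cases hj : j = i₀
    · subst hj
      simp only [if_true]
      exact ⟨by linarith, hle x hxD⟩
    · simp only [if_neg hj]
      have h1 := hcap x hxD j hj
      have h2 : (1 - L x i₀) ^ γ ≤ u ^ γ :=
        Real.rpow_le_rpow (by linarith [hle x hxD]) hxu' hγ
      have h3 := abs_le.1 (h1.trans (mul_le_mul_of_nonneg_left h2 hC.le))
      constructor <;> linarith [h3.1, h3.2]
  refine (measure_mono hsub).trans ?_
  rw [Measure.addHaar_preimage_linearEquiv, volume_pi_pi, mul_assoc,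
    ENNReal.ofReal_mul (abs_nonneg _)]
  gcongr
  rw [← Finset.mul_prod_erase _ _ (Finset.mem_univ i₀)]
  have h1 : ∏ x ∈ Finset.univ.erase i₀, volume (if x = i₀ then Set.Icc (1 - u) 1
      else Set.Icc (L x₀ x - C * u ^ γ) (L x₀ x + C * u ^ γ)) =
      ∏ x ∈ Finset.univ.erase i₀, ENNReal.ofReal (2 * C * u ^ γ) := by
    refine Finset.prod_congr rfl fun j hj => ?_
    rw [if_neg (Finset.ne_of_mem_erase hj), Real.volume_Icc]
    congr 1
    ring
  rw [h1, Finset.prod_const, Finset.card_erase_of_mem (Finset.mem_univ _), Finset.card_univ,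
    Fintype.card_fin, if_pos rfl, Real.volume_Icc, ← ENNReal.ofReal_pow (by positivity),
    ← ENNReal.ofReal_mul (by linarith)]
  apply ENNReal.ofReal_le_ofReal
  have e : u ^ (1 + γ * ((d : ℝ) - 1)) = u * (u ^ γ) ^ (d - 1) := by
    rw [Real.rpow_add hu, Real.rpow_one, Real.rpow_mul hu.le, ← Nat.cast_pred hd,
      Real.rpow_natCast]
  rw [e, mul_pow]
  apply le_of_eq
  ring

/-- Dyadic bound of the `L²` norm of a concentrated polynomial. -/
theorem integral_concentrated_le {d : ℕ} {D : Set (Fin d → ℝ)} (hD : IsCompact D)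
    {ℓ g : (Fin d → ℝ) → ℝ} (hℓ : Continuous ℓ) (hg : Continuous g) {V β A : ℝ} {k : ℕ}
    (hV : 0 ≤ V) (hA : 0 < A) (hk : β ≤ k) (hk1 : 1 ≤ k)
    (hcap : ∀ u > 0, volume (D ∩ {x | ℓ x ≤ u}) ≤ ENNReal.ofReal (V * u ^ β))
    (hg1 : ∀ x ∈ D, |g x| ≤ 1) (hg2 : ∀ x ∈ D, |g x| * (A * ℓ x) ≤ 2) :
    ∫ x in D, (g x ^ k) ^ 2 ≤ 2 * 16 ^ k * V * A ^ (-β) := by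
  set E : ℕ → Set (Fin d → ℝ) := fun j => {x | A * ℓ x ≤ 2 ^ j} with hE
  have hEm : ∀ j, MeasurableSet (E j) := fun j =>
    (isClosed_le (by fun_prop) continuous_const).measurableSet
  set w : ℕ → ℝ := fun j => ((4 / 2 ^ j) ^ k) ^ 2 with hw
  have hpt : ∀ x ∈ D, ENNReal.ofReal ((g x ^ k) ^ 2) ≤
      ∑' j, (E j).indicator (fun _ => ENNReal.ofReal (w j)) x := by
    intro x hx
    have hex : ∃ j : ℕ, A * ℓ x ≤ 2 ^ j := by
      obtain ⟨j, hj⟩ := pow_unbounded_of_one_lt (A * ℓ x) (one_lt_two)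
      exact ⟨j, hj.le⟩
    classical
    -- Take the least dyadic level containing `x`. Failure at level `j - 1` turns the decay of `g`
    -- into `|g x| ≤ 2/2^(j-1) = 4/2^j`; at `j = 0` the trivial bound suffices.
    set j := Nat.find hex with hj
    refine le_trans ?_ (ENNReal.le_tsum j)
    rw [Set.indicator_of_mem (show x ∈ E j from Nat.find_spec hex)]
    apply ENNReal.ofReal_le_ofReal
    have hgle : |g x| ≤ 4 / 2 ^ j := by
      rcases Nat.eq_zero_or_pos j with h0 | h0
      · rw [h0, pow_zero]
        linarith [hg1 x hx]
      · obtain ⟨i, hi⟩ := Nat.exists_eq_succ_of_ne_zero h0.ne'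
        have h1 : ¬ (A * ℓ x ≤ 2 ^ i) := Nat.find_min hex (by omega)
        rw [hi, pow_succ, le_div_iff₀ (by positivity)]
        have h2 := mul_le_mul_of_nonneg_left (not_le.1 h1).le (abs_nonneg (g x))
        linarith [hg2 x hx]
    calc (g x ^ k) ^ 2 = (|g x| ^ k) ^ 2 := by rw [← abs_pow, sq_abs]
      _ ≤ ((4 / 2 ^ j) ^ k) ^ 2 := by gcongr
  -- Since `k ≥ β`, the decay `2^(-2jk)` of `g^(2k)` beats the growth `2^(jβ)` of the caps, leaving
  -- a convergent geometric series.
  have hterm : ∀ j : ℕ, w j * (V * (2 ^ j / A) ^ β) ≤ 16 ^ k * V * A ^ (-β) * (1 / 2) ^ j := by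
    intro j
    have e1 : ((2 : ℝ) ^ j / A) ^ β = ((2 : ℝ) ^ j) ^ β * A ^ (-β) := by
      rw [Real.div_rpow (by positivity) hA.le, Real.rpow_neg hA.le, div_eq_mul_inv]
    have e2 : ((2 : ℝ) ^ j) ^ β ≤ ((2 : ℝ) ^ j) ^ k := by
      rw [← Real.rpow_natCast _ k]
      exact Real.rpow_le_rpow_of_exponent_le (one_le_pow₀ one_le_two) hk
    have e3 : w j * ((2 : ℝ) ^ j) ^ k ≤ 16 ^ k * (1 / 2) ^ j := by
      have : w j * ((2 : ℝ) ^ j) ^ k = 16 ^ k * ((1 / 2) ^ j) ^ k := by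
        rw [hw]
        simp only [div_pow, one_pow]
        rw [← pow_mul 4 k 2, mul_comm k 2, pow_mul 4 2 k]
        norm_num
        field_simp
      rw [this]
      gcongr
      exact pow_le_of_le_one (by positivity) (pow_le_one₀ (by norm_num) (by norm_num)) (by omega)
    have hw0 : 0 ≤ w j := sq_nonneg _
    have hA0 : 0 ≤ A ^ (-β) := Real.rpow_nonneg hA.le _
    rw [e1]
    calc w j * (V * (((2 : ℝ) ^ j) ^ β * A ^ (-β)))
        ≤ w j * (V * (((2 : ℝ) ^ j) ^ k * A ^ (-β))) := by gcongr
      _ = (w j * ((2 : ℝ) ^ j) ^ k) * V * A ^ (-β) := by ring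
      _ ≤ (16 ^ k * (1 / 2) ^ j) * V * A ^ (-β) := by gcongr
      _ = _ := by ring
  have hint : Integrable (fun x => (g x ^ k) ^ 2) (volume.restrict D) :=
    ((hg.pow k).pow 2).continuousOn.integrableOn_compact hD
  have hB : 0 ≤ 16 ^ k * V * A ^ (-β) := by
    have hA0 : 0 ≤ A ^ (-β) := Real.rpow_nonneg hA.le _
    positivity
  have hmain : ENNReal.ofReal (∫ x in D, (g x ^ k) ^ 2) ≤
      ENNReal.ofReal (16 ^ k * V * A ^ (-β) * 2) := by
    rw [ofReal_integral_eq_lintegral_ofReal hint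
      (Filter.Eventually.of_forall fun x => sq_nonneg _)]
    calc ∫⁻ x in D, ENNReal.ofReal ((g x ^ k) ^ 2)
        ≤ ∫⁻ x in D, ∑' j, (E j).indicator (fun _ => ENNReal.ofReal (w j)) x :=
          setLIntegral_mono' hD.measurableSet hpt
      _ = ∑' j, ENNReal.ofReal (w j) * volume.restrict D (E j) := by
          rw [lintegral_tsum fun j => (measurable_const.indicator (hEm j)).aemeasurable]
          congr 1
          ext j
          rw [lintegral_indicator_const (hEm j)]
      _ ≤ ∑' j, ENNReal.ofReal (16 ^ k * V * A ^ (-β) * (1 / 2) ^ j) := by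
          refine ENNReal.tsum_le_tsum fun j => ?_
          refine le_trans ?_ (ENNReal.ofReal_le_ofReal (hterm j))
          rw [ENNReal.ofReal_mul (sq_nonneg _), Measure.restrict_apply (hEm j), Set.inter_comm]
          gcongr
          refine le_trans (measure_mono ?_) (hcap (2 ^ j / A) (by positivity))
          rintro x ⟨hx1, hx2⟩
          exact ⟨hx1, by rw [Set.mem_ofPred_eq, le_div_iff₀ hA, mul_comm]; exact hx2⟩
      _ = ENNReal.ofReal (16 ^ k * V * A ^ (-β) * 2) := by
          rw [← ENNReal.ofReal_tsum_of_nonneg (fun j => by positivity)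
            (summable_geometric_two.mul_left _), tsum_mul_left, tsum_geometric_two]
  rw [ENNReal.ofReal_le_ofReal_iff (by positivity)] at hmain
  linarith

/-- Existence of polynomials concentrated at a boundary point of `D`, when the caps of `D` at
this point have width `O(u^γ)` at depth `u`. -/
theorem exists_concentrated_polySpace {d : ℕ} {D : Set (Fin d → ℝ)} (hD : IsCompact D)
    (L : (Fin d → ℝ) ≃ₗ[ℝ] (Fin d → ℝ)) (i₀ : Fin d) {x₀ : Fin d → ℝ} (hx₀ : L x₀ i₀ = 1)
    {C γ : ℝ} (hC : 0 < C) (hγ : 0 ≤ γ) (hle : ∀ x ∈ D, L x i₀ ≤ 1) (hge : ∀ x ∈ D, -1 ≤ L x i₀)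
    (hcap : ∀ x ∈ D, ∀ j ≠ i₀, |L x j - L x₀ j| ≤ C * (1 - L x i₀) ^ γ) :
    ∃ κ > 0, ∀ n : ℕ, 1 ≤ n → ∃ f ∈ polySpace d n, f x₀ = 1 ∧
      (∫ y in D, f y ^ 2) * (n : ℝ) ^ (2 * (1 + γ * ((d : ℝ) - 1))) ≤ κ := by
  have hd : 1 ≤ d := Nat.one_le_of_lt i₀.2
  set β : ℝ := 1 + γ * ((d : ℝ) - 1) with hβ
  have hβ1 : 1 ≤ β := by
    have : (1 : ℝ) ≤ d := by exact_mod_cast hd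
    nlinarith
  set V : ℝ := |LinearMap.det (L.symm : (Fin d → ℝ) →ₗ[ℝ] (Fin d → ℝ))| * (2 * C) ^ (d - 1) with hV
  have hV0 : 0 ≤ V := by positivity
  set k : ℕ := ⌈β⌉₊ with hk
  have hkβ : β ≤ k := Nat.le_ceil β
  have hk1 : 1 ≤ k := by exact_mod_cast hβ1.trans hkβ
  have hk0 : (0 : ℝ) < k := by exact_mod_cast hk1
  refine ⟨2 * 16 ^ k * V * (k : ℝ) ^ (2 * β) + 1, by positivity, fun n hn => ?_⟩
  have hn0 : (0 : ℝ) < n := by exact_mod_cast hn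
  -- This `m` gives `k(m - 1) ≤ n ≤ km`: the degree of `F^k` is admissible and `m` is still
  -- comparable to `n`.
  set m : ℕ := n / k + 1 with hm
  have hm1 : 1 ≤ m := Nat.le_add_left 1 _
  have hm0 : (0 : ℝ) < m := by exact_mod_cast hm1
  have hnm : (n : ℝ) ≤ k * m := by exact_mod_cast (Nat.lt_mul_div_succ n hk1).le
  obtain ⟨F, hFdeg, hF1, hF⟩ := Polynomial.exists_concentrated hm1
  have hLc : Continuous fun x => L x i₀ :=
    (continuous_apply i₀).comp L.toLinearMap.continuous_of_finiteDimensional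
  have hmem : (fun x => F.eval (L x i₀) ^ k) ∈ polySpace d n := by
    have h1 := polySpace_comp_affine (polySpace_eval_coord (F ^ k) i₀) 0 L.toLinearMap
    have h2 := polySpace_mono (n := n) (by
      refine (Polynomial.natDegree_pow_le (p := F) (n := k)).trans
        ((Nat.mul_le_mul_left k hFdeg).trans ?_)
      rw [hm, Nat.add_sub_cancel]
      exact Nat.mul_div_le n k) h1
    simpa using h2
  refine ⟨_, hmem, by simp [hx₀, hF1], ?_⟩
  have hint := integral_concentrated_le (A := (m : ℝ) ^ 2) hD (ℓ := fun x => 1 - L x i₀)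
    (g := fun x => F.eval (L x i₀)) (by fun_prop) (F.continuous.comp hLc) hV0 (by positivity)
    hkβ hk1 (fun u hu => volume_cap_le L i₀ x₀ hC hγ hle hcap hu)
    (fun x hx => (hF _ ⟨hge x hx, hle x hx⟩).1) (fun x hx => (hF _ ⟨hge x hx, hle x hx⟩).2)
  have e1 : ((m : ℝ) ^ 2) ^ (-β) = ((m : ℝ) ^ (2 * β))⁻¹ := by
    rw [Real.rpow_neg (by positivity), Real.rpow_mul hm0.le, Real.rpow_two]
  have e2 : (n : ℝ) ^ (2 * β) ≤ (k : ℝ) ^ (2 * β) * (m : ℝ) ^ (2 * β) := by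
    rw [← Real.mul_rpow hk0.le hm0.le]
    exact Real.rpow_le_rpow hn0.le hnm (by linarith)
  rw [e1] at hint
  have hmp : 0 < (m : ℝ) ^ (2 * β) := Real.rpow_pos_of_pos hm0 _
  calc (∫ y in D, (F.eval (L y i₀) ^ k) ^ 2) * (n : ℝ) ^ (2 * β)
      ≤ (2 * 16 ^ k * V * ((m : ℝ) ^ (2 * β))⁻¹) * ((k : ℝ) ^ (2 * β) * (m : ℝ) ^ (2 * β)) := by
        gcongr
    _ = 2 * 16 ^ k * V * (k : ℝ) ^ (2 * β) := by field_simp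
    _ ≤ _ := by linarith

/-! ### The `ℓ_p` balls as convex bodies, and the reduction to ellipsoids and caps. -/

theorem mem_lpUnitBall_iff {d : ℕ} {p : ℝ≥0∞} (hp : 0 < p.toReal) {x : Fin d → ℝ} :
    x ∈ lpUnitBall d p ↔ ∑ i, |x i| ^ p.toReal ≤ 1 := by
  rw [lpUnitBall, Set.mem_ofPred_eq, PiLp.norm_eq_sum hp]
  simp only [Real.norm_eq_abs]
  have h0 : 0 ≤ ∑ i, |x i| ^ p.toReal :=
    Finset.sum_nonneg fun i _ => Real.rpow_nonneg (abs_nonneg _) _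
  have h1 := Real.rpow_le_rpow_iff h0 zero_le_one (one_div_pos.2 hp)
  rwa [Real.one_rpow] at h1

theorem mem_lpUnitBall_top_iff {d : ℕ} {x : Fin d → ℝ} :
    x ∈ lpUnitBall d ∞ ↔ ∀ i, |x i| ≤ 1 := by
  have : ‖WithLp.toLp ∞ x‖ = ‖x‖ := PiLp.norm_toLp x
  rw [lpUnitBall, Set.mem_ofPred_eq, this]
  exact pi_norm_le_iff_of_nonneg zero_le_one

theorem lpUnitBall_eq_preimage {d : ℕ} {p : ℝ≥0∞} [Fact (1 ≤ p)] :
    lpUnitBall d p = (PiLp.continuousLinearEquiv p ℝ (fun _ : Fin d => ℝ)).symm ⁻¹'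
      Metric.closedBall 0 1 := by
  ext x
  rw [Set.mem_preimage, mem_closedBall_zero_iff]
  rfl

theorem convex_lpUnitBall {d : ℕ} {p : ℝ≥0∞} (hp : 1 ≤ p) : Convex ℝ (lpUnitBall d p) := by
  have : Fact (1 ≤ p) := ⟨hp⟩
  rw [lpUnitBall_eq_preimage]
  exact (convex_closedBall _ _).linear_preimage
    (PiLp.continuousLinearEquiv p ℝ (fun _ : Fin d => ℝ)).symm.toLinearEquiv.toLinearMap

theorem isCompact_lpUnitBall {d : ℕ} {p : ℝ≥0∞} (hp : 1 ≤ p) : IsCompact (lpUnitBall d p) := by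
  have : Fact (1 ≤ p) := ⟨hp⟩
  rw [lpUnitBall_eq_preimage]
  exact (PiLp.continuousLinearEquiv p ℝ
    (fun _ : Fin d => ℝ)).symm.toHomeomorph.isCompact_preimage.2 (isCompact_closedBall _ _)

theorem interior_lpUnitBall_nonempty {d : ℕ} {p : ℝ≥0∞} (hp : 1 ≤ p) :
    (interior (lpUnitBall d p)).Nonempty := by
  have : Fact (1 ≤ p) := ⟨hp⟩
  refine ⟨0, mem_interior_iff_mem_nhds.2 ?_⟩
  rw [lpUnitBall_eq_preimage]
  refine (PiLp.continuousLinearEquiv p ℝ (fun _ : Fin d => ℝ)).symm.continuous.continuousAt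
    |>.preimage_mem_nhds ?_
  rw [map_zero]
  exact Metric.closedBall_mem_nhds _ one_pos

/-- The final two-sided estimate for a convex body, from inscribed ellipsoids and a boundary
point with controlled caps. -/
theorem approxPow_of_ellipsoids_of_caps {d : ℕ} {D : Set (Fin d → ℝ)} (hconv : Convex ℝ D)
    (hD : IsCompact D) (hne : (interior D).Nonempty) {σ κ : ℝ} (hκ : 0 < κ)
    (hell : ∀ n : ℕ, 1 ≤ n → ∀ x ∈ D, ∃ (c y : Fin d → ℝ) (T : (Fin d → ℝ) →ₗ[ℝ] (Fin d → ℝ)),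
      (∀ z : Fin d → ℝ, z ⬝ᵥ z ≤ 1 → c + T z ∈ D) ∧ y ⬝ᵥ y ≤ 1 + 1 / (100 * n ^ 2) ∧
      c + T y = x ∧ κ * (n : ℝ) ^ (d + 1 - σ) ≤ |LinearMap.det T|)
    (L : (Fin d → ℝ) ≃ₗ[ℝ] (Fin d → ℝ)) (i₀ : Fin d) {x₀ : Fin d → ℝ} (hx₀D : x₀ ∈ D)
    (hx₀ : L x₀ i₀ = 1) {C γ : ℝ} (hC : 0 < C) (hγ : 0 ≤ γ)
    (hσ : σ = 2 * (1 + γ * ((d : ℝ) - 1)))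
    (hle : ∀ x ∈ D, L x i₀ ≤ 1) (hge : ∀ x ∈ D, -1 ≤ L x i₀)
    (hcap : ∀ x ∈ D, ∀ j ≠ i₀, |L x j - L x₀ j| ≤ C * (1 - L x i₀) ^ γ) :
    ApproxPow (christoffelSup D) σ ∧ ApproxPow (nikolskiiSup D) (σ / 2) := by
  obtain ⟨κ₁, hκ₁, hup⟩ := polySpace_sq_le_of_ellipsoids (Nat.zero_lt_of_lt i₀.2) hD hκ hell
  obtain ⟨κ₂, hκ₂, hlow⟩ := exists_concentrated_polySpace hD L i₀ hx₀ hC hγ hle hge hcap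
  rw [← hσ] at hlow
  refine approxPow_christoffelSup_nikolskiiSup hD hne hx₀D ?_ hκ₁ hκ₂ hup hlow
  rw [hconv.closure_interior_eq_closure_of_nonempty_interior hne]
  exact subset_closure hx₀D

/-- The linear automorphism replacing the coordinate `i₀` by `a` times the sum of all of them. -/
noncomputable def sumShear {d : ℕ} (i₀ : Fin d) (a : ℝ) (ha : a ≠ 0) :
    (Fin d → ℝ) ≃ₗ[ℝ] (Fin d → ℝ) :=
  LinearEquiv.ofInjectiveEndo
    (LinearMap.pi fun j => if j = i₀ then a • ∑ k, LinearMap.proj k else LinearMap.proj j) (by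
      rw [← LinearMap.ker_eq_bot, LinearMap.ker_eq_bot']
      intro x hx
      have hj : ∀ j, j ≠ i₀ → x j = 0 := fun j hj => by
        simpa [hj] using congrFun hx j
      have h0 : ∑ k, x k = 0 := by
        simpa [ha] using congrFun hx i₀
      rw [Finset.sum_eq_single i₀ (fun j _ h => hj j h) (by simp)] at h0
      ext j
      by_cases h : j = i₀
      · rw [h, h0, Pi.zero_apply]
      · rw [hj j h, Pi.zero_apply])

theorem sumShear_apply_self {d : ℕ} (i₀ : Fin d) (a : ℝ) (ha : a ≠ 0) (x : Fin d → ℝ) :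
    sumShear i₀ a ha x i₀ = a * ∑ k, x k := by
  simp [sumShear]

theorem sumShear_apply_of_ne {d : ℕ} {i₀ j : Fin d} (hj : j ≠ i₀) (a : ℝ) (ha : a ≠ 0)
    (x : Fin d → ℝ) : sumShear i₀ a ha x j = x j := by
  simp [sumShear, hj]

/-! ### Ellipsoids inscribed in `ℓ_p` balls. -/

/-- Ellipsoids inscribed in the unit ball of `ℓ_q`, `1 ≤ q ≤ 2`. -/
theorem exists_ellipsoid_of_le_two {d : ℕ} (hd : 0 < d) {q : ℝ} (hq1 : 1 ≤ q) (hq2 : q ≤ 2)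
    {n : ℕ} (hn : 1 ≤ n) {x : Fin d → ℝ} (hx : ∑ i, |x i| ^ q ≤ 1) :
    ∃ (c y : Fin d → ℝ) (T : (Fin d → ℝ) →ₗ[ℝ] (Fin d → ℝ)),
      (∀ z : Fin d → ℝ, z ⬝ᵥ z ≤ 1 → ∑ i, |(c + T z) i| ^ q ≤ 1) ∧
      y ⬝ᵥ y ≤ 1 + 1 / (100 * n ^ 2) ∧ c + T y = x ∧
      ((1 / d : ℝ) ^ (1 / q - 1 / 2) * ((1 / (200 * d) : ℝ) ^ (1 / q - 1 / 2)) ^ (d - 1)) *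
        (n : ℝ) ^ (d + 1 - 2 * (1 + 1 / q * ((d : ℝ) - 1))) ≤ |LinearMap.det T| := by
  have hd' : (0 : ℝ) < d := by exact_mod_cast hd
  have hn1 : (1 : ℝ) ≤ n := by exact_mod_cast hn
  have hq0 : 0 < q := by linarith
  -- Semi-axes `τᵢ^α` with `∑ τᵢ = 1` stay in the ball by weighted AM–GM: `(τᵢ^α |zᵢ|)^q ≤ (1 - q/2)
  -- τᵢ + (q/2) zᵢ²`. The choice `τᵢ = |xᵢ|^q` would put a boundary point `x` exactly on the
  -- ellipsoid.
  set α : ℝ := 1 / q - 1 / 2 with hα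
  have hα0 : 0 ≤ α := by
    rw [hα, sub_nonneg]
    exact one_div_le_one_div_of_le hq0 hq2
  have hαq : α * q = 1 - q / 2 := by rw [hα]; field_simp
  set δ : ℝ := 1 / (200 * n ^ 2) with hδ
  have hδ0 : 0 < δ := by positivity
  have hδ1 : δ ≤ 1 / 2 := by
    rw [hδ]
    apply one_div_le_one_div_of_le <;> nlinarith
  have hxn : ∀ i, 0 ≤ |x i| ^ q := fun i => Real.rpow_nonneg (abs_nonneg _) _
  -- For `x` inside the ball, the missing mass goes to one coordinate so that the weights sum to 1.
  set s : Fin d → ℝ := (fun i => |x i| ^ q) + Pi.single ⟨0, hd⟩ (1 - ∑ i, |x i| ^ q) with hs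
  have hsx : ∀ i, |x i| ^ q ≤ s i := fun i => by
    have : (0 : Fin d → ℝ) ≤ Pi.single ⟨0, hd⟩ (1 - ∑ i, |x i| ^ q) :=
      Pi.single_nonneg.2 (by linarith)
    rw [hs, Pi.add_apply]
    linarith [this i, Pi.zero_apply (M := fun _ : Fin d => ℝ) i]
  have hssum : ∑ i, s i = 1 := by
    simp [hs, Finset.sum_add_distrib]
  have hs0 : ∀ i, 0 ≤ s i := fun i => (hxn i).trans (hsx i)
  -- The floor `δ/d` keeps the ellipsoid from degenerating. It pushes `x` outside by a factor at
  -- most `1/(1 - δ) ≤ 1 + 2δ` in squared length, exactly the allowed slack `1/(100n²)`.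
  set τ : Fin d → ℝ := fun i => (1 - δ) * s i + δ / d with hτ
  have hτδ : ∀ i, δ / d ≤ τ i := fun i => by
    have := mul_nonneg (by linarith : 0 ≤ 1 - δ) (hs0 i)
    rw [hτ]
    linarith
  have hτ0 : ∀ i, 0 < τ i := fun i => (by positivity : 0 < δ / d).trans_le (hτδ i)
  have hτsum : ∑ i, τ i = 1 := by
    rw [hτ, Finset.sum_add_distrib, ← Finset.mul_sum, hssum, Finset.sum_const, Finset.card_univ,
      Fintype.card_fin, nsmul_eq_mul]
    field_simp
    ring
  have hT : ∀ z : Fin d → ℝ, ∀ i,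
      Matrix.toLin' (Matrix.diagonal fun i => τ i ^ α) z i = τ i ^ α * z i := fun z i => by
    rw [Matrix.toLin'_apply, Matrix.mulVec_diagonal]
  refine ⟨0, fun i => x i * τ i ^ (-α), Matrix.toLin' (Matrix.diagonal fun i => τ i ^ α),
    fun z hz => ?_, ?_, ?_, ?_⟩
  · have hterm : ∀ i, |(0 + Matrix.toLin' (Matrix.diagonal fun i => τ i ^ α) z) i| ^ q ≤
        (1 - q / 2) * τ i + q / 2 * (z i * z i) := by
      intro i
      rw [zero_add, hT, abs_mul, abs_of_pos (Real.rpow_pos_of_pos (hτ0 i) _),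
        Real.mul_rpow (Real.rpow_nonneg (hτ0 i).le _) (abs_nonneg _), ← Real.rpow_mul (hτ0 i).le,
        hαq]
      have e : |z i| ^ q = (z i * z i) ^ (q / 2) := by
        rw [← abs_mul_abs_self, ← sq, ← Real.rpow_natCast, ← Real.rpow_mul (abs_nonneg _)]
        congr 1
        push_cast
        ring
      rw [e]
      exact Real.geom_mean_le_arith_mean2_weighted (by linarith) (by linarith) (hτ0 i).le
        (mul_self_nonneg _) (by ring)
    refine (Finset.sum_le_sum fun i _ => hterm i).trans ?_
    rw [Finset.sum_add_distrib, ← Finset.mul_sum, ← Finset.mul_sum, hτsum]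
    have hz' : ∑ i, z i * z i ≤ 1 := hz
    nlinarith
  · have hterm : ∀ i, (x i * τ i ^ (-α)) * (x i * τ i ^ (-α)) ≤ s i / (1 - δ) := by
      intro i
      have h1δ : 0 < 1 - δ := by linarith
      have e1 : (x i * τ i ^ (-α)) * (x i * τ i ^ (-α)) = x i ^ 2 * τ i ^ (-(2 * α)) := by
        have : τ i ^ (-(2 * α)) = τ i ^ (-α) * τ i ^ (-α) := by
          rw [← Real.rpow_add (hτ0 i)]; congr 1; ring
        rw [this]; ring
      have e2 : x i ^ 2 ≤ s i * s i ^ (2 * α) := by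
        have : s i * s i ^ (2 * α) = s i ^ (2 / q) := by
          rw [show (2 / q : ℝ) = 1 + 2 * α by rw [hα]; ring,
            Real.rpow_add_of_nonneg (hs0 i) zero_le_one (by positivity), Real.rpow_one]
        rw [this, ← sq_abs, ← Real.rpow_natCast]
        calc |x i| ^ ((2 : ℕ) : ℝ) = (|x i| ^ q) ^ (2 / q) := by
              rw [← Real.rpow_mul (abs_nonneg _)]; congr 1; push_cast; field_simp
          _ ≤ s i ^ (2 / q) := Real.rpow_le_rpow (hxn i) (hsx i) (by positivity)
      have e3 : s i ^ (2 * α) * τ i ^ (-(2 * α)) ≤ 1 / (1 - δ) := by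
        have h2 : s i / τ i ≤ 1 / (1 - δ) := by
          rw [div_le_div_iff₀ (hτ0 i) h1δ, one_mul, mul_comm]
          have : 0 ≤ δ / d := by positivity
          rw [hτ]; linarith
        rw [Real.rpow_neg (hτ0 i).le, ← div_eq_mul_inv, ← Real.div_rpow (hs0 i) (hτ0 i).le]
        have h3 : 1 ≤ 1 / (1 - δ) := by rw [le_div_iff₀ h1δ]; linarith
        calc (s i / τ i) ^ (2 * α) ≤ (1 / (1 - δ)) ^ (2 * α) :=
              Real.rpow_le_rpow (div_nonneg (hs0 i) (hτ0 i).le) h2 (by positivity)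
          _ ≤ (1 / (1 - δ)) ^ (1 : ℝ) := by
              -- Here `q ≥ 1` enters, as `2α ≤ 1`.
              refine Real.rpow_le_rpow_of_exponent_le h3 ?_
              have : 1 / q ≤ 1 := by rw [div_le_one hq0]; exact hq1
              rw [hα]; linarith
          _ = 1 / (1 - δ) := Real.rpow_one _
      rw [e1]
      calc x i ^ 2 * τ i ^ (-(2 * α)) ≤ (s i * s i ^ (2 * α)) * τ i ^ (-(2 * α)) := by
            have := Real.rpow_nonneg (hτ0 i).le (-(2 * α))
            gcongr
        _ = s i * (s i ^ (2 * α) * τ i ^ (-(2 * α))) := by ring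
        _ ≤ s i * (1 / (1 - δ)) := by
            have := hs0 i
            gcongr
        _ = s i / (1 - δ) := by ring
    refine (Finset.sum_le_sum fun i _ => hterm i).trans ?_
    rw [← Finset.sum_div, hssum, div_le_iff₀ (by linarith)]
    have : 1 / (100 * (n : ℝ) ^ 2) = 2 * δ := by rw [hδ]; field_simp; norm_num
    rw [this]
    nlinarith
  · ext i
    rw [zero_add, hT, mul_left_comm, ← Real.rpow_add (hτ0 i), add_neg_cancel, Real.rpow_zero,
      mul_one]
  -- One weight is at least the average `1/d`, so only `d - 1` semi-axes can be as short as
  -- `(δ/d)^α`; this gives `n^(-2α(d-1))`.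
  · obtain ⟨j, -, hj⟩ : ∃ j ∈ Finset.univ, 1 / (d : ℝ) ≤ τ j := by
      refine Finset.exists_le_of_sum_le ⟨⟨0, hd⟩, Finset.mem_univ _⟩ ?_
      rw [hτsum, Finset.sum_const, Finset.card_univ, Fintype.card_fin, nsmul_eq_mul,
        mul_one_div_cancel hd'.ne']
    rw [LinearMap.det_toLin', Matrix.det_diagonal, abs_of_pos
      (Finset.prod_pos fun i _ => Real.rpow_pos_of_pos (hτ0 i) _),
      ← Finset.mul_prod_erase _ _ (Finset.mem_univ j)]
    have h1 : (1 / (d : ℝ)) ^ α ≤ τ j ^ α := Real.rpow_le_rpow (by positivity) hj hα0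
    have h2 : ((δ / d) ^ α) ^ (d - 1) ≤ ∏ i ∈ Finset.univ.erase j, τ i ^ α := by
      have : (d - 1) = (Finset.univ.erase j).card := by
        rw [Finset.card_erase_of_mem (Finset.mem_univ _), Finset.card_univ, Fintype.card_fin]
      rw [this, ← Finset.prod_const]
      exact Finset.prod_le_prod (fun i _ => Real.rpow_nonneg (by positivity) _)
        fun i _ => Real.rpow_le_rpow (by positivity) (hτδ i) hα0
    have h3 : ((1 / (200 * d) : ℝ) ^ α) ^ (d - 1) *
        (n : ℝ) ^ (d + 1 - 2 * (1 + 1 / q * ((d : ℝ) - 1))) = ((δ / d) ^ α) ^ (d - 1) := by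
      have e : (n : ℝ) ^ (d + 1 - 2 * (1 + 1 / q * ((d : ℝ) - 1))) =
          (((n : ℝ) ^ (-2 : ℝ)) ^ α) ^ (d - 1) := by
        rw [← Real.rpow_natCast, ← Real.rpow_mul (by positivity), ← Real.rpow_mul (by positivity),
          Nat.cast_pred hd]
        congr 1
        rw [hα]
        ring
      rw [e, ← mul_pow, ← Real.mul_rpow (by positivity) (by positivity),
        Real.rpow_neg (by positivity), Real.rpow_two]
      congr 2
      rw [hδ]
      field_simp
    rw [mul_assoc, h3]
    have := Real.rpow_nonneg (hτ0 j).le α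
    gcongr

/-- With `r = p - 2` this is, up to the factor `p`, a Lipschitz bound for the derivative of `|t|^p`,
hence the source of the quadratic bound below. The range 3 covers `|a + t|` with `|a| ≤ 1` and `|t|
≤ 2`. -/
theorem abs_rpow_mul_self_sub_le {r : ℝ} (hr : 0 ≤ r) {x y : ℝ} (hx : |x| ≤ 3) (hy : |y| ≤ 3) :
    |(|y| ^ r * y) - |x| ^ r * x| ≤ (r + 1) * 3 ^ r * |y - x| := by
  have hK : 0 ≤ (r + 1) * (3 : ℝ) ^ r := by positivity
  have hpos : ∀ x y : ℝ, 0 ≤ x → 0 ≤ y → x ≤ 3 → y ≤ 3 →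
      |(|y| ^ r * y) - |x| ^ r * x| ≤ (r + 1) * 3 ^ r * |y - x| := by
    intro x y hx0 hy0 hx hy
    have e : ∀ t : ℝ, 0 ≤ t → |t| ^ r * t = t ^ (r + 1) := fun t ht => by
      rw [abs_of_nonneg ht, Real.rpow_add_of_nonneg ht hr zero_le_one, Real.rpow_one]
    rw [e x hx0, e y hy0]
    refine Convex.norm_image_sub_le_of_norm_hasDerivWithin_le (s := Set.Icc (0 : ℝ) 3)
      (f := fun t : ℝ => t ^ (r + 1)) (f' := fun t => (r + 1) * t ^ (r + 1 - 1))
      (fun t _ => (Real.hasDerivAt_rpow_const (Or.inr (by linarith))).hasDerivWithinAt)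
      (fun t ht => ?_) (convex_Icc _ _) ⟨hx0, hx⟩ ⟨hy0, hy⟩
    rw [add_sub_cancel_right, Real.norm_eq_abs,
      abs_of_nonneg (mul_nonneg (by linarith) (Real.rpow_nonneg ht.1 _))]
    exact mul_le_mul_of_nonneg_left (Real.rpow_le_rpow ht.1 ht.2 hr) (by linarith)
  have hx3 := abs_le.1 hx
  have hy3 := abs_le.1 hy
  have hmix : ∀ x y : ℝ, x ≤ 0 → 0 ≤ y → -3 ≤ x → y ≤ 3 →
      |(|y| ^ r * y) - |x| ^ r * x| ≤ (r + 1) * 3 ^ r * |y - x| := by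
    intro x y hx0 hy0 hx hy
    have h1 := hpos 0 y le_rfl hy0 (by norm_num) hy
    have h2 := hpos 0 (-x) le_rfl (by linarith) (by norm_num) (by linarith)
    rw [mul_zero, sub_zero, sub_zero, abs_of_nonneg hy0] at h1
    rw [mul_zero, sub_zero, sub_zero, abs_neg] at h2
    have h3 := le_abs_self (y ^ r * y)
    have h4 := le_abs_self (|x| ^ r * -x)
    have h5 : 0 ≤ |x| ^ r * -x := mul_nonneg (Real.rpow_nonneg (abs_nonneg _) _) (by linarith)
    have h6 : 0 ≤ y ^ r * y := mul_nonneg (Real.rpow_nonneg hy0 _) hy0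
    have h7 : (r + 1) * 3 ^ r * |x| = (r + 1) * 3 ^ r * (-x) := by rw [abs_of_nonpos hx0]
    rw [abs_of_nonneg hy0, abs_of_nonneg (by linarith : 0 ≤ y ^ r * y - |x| ^ r * x),
      abs_of_nonneg (by linarith : 0 ≤ y - x)]
    linarith
  rcases le_total 0 x with hx0 | hx0 <;> rcases le_total 0 y with hy0 | hy0
  · exact hpos x y hx0 hy0 hx3.2 hy3.2
  · rw [abs_sub_comm, abs_sub_comm y x]
    exact hmix y x hy0 hx0 hy3.1 hx3.2
  · exact hmix x y hx0 hy0 hx3.1 hy3.2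
  · have := hpos (-x) (-y) (by linarith) (by linarith) (by linarith) (by linarith)
    rw [abs_neg, abs_neg] at this
    rw [← abs_neg, ← abs_neg (y - x)]
    convert! this using 2 <;> ring_nf

/-- Quadratic upper bound for `|t|^p` with `p ≥ 2`. -/
theorem abs_add_rpow_le {p : ℝ} (hp : 2 ≤ p) {a h : ℝ} (ha : |a| ≤ 1) (hh : |h| ≤ 2) :
    |a + h| ^ p ≤ |a| ^ p + p * |a| ^ (p - 2) * a * h + p * ((p - 1) * 3 ^ (p - 2)) * h ^ 2 := by
  have hmv := Convex.norm_image_sub_le_of_norm_hasDerivWithin_le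
    (f := fun t : ℝ => |a + t| ^ p - p * |a| ^ (p - 2) * a * t)
    (f' := fun t => p * |a + t| ^ (p - 2) * (a + t) - p * |a| ^ (p - 2) * a)
    (s := Set.Icc (-|h|) |h|) (C := p * ((p - 1) * 3 ^ (p - 2)) * |h|) (x := 0) (y := h)
    (fun t _ => by
      have h1 := (hasDerivAt_abs_rpow (a + t) (by linarith : 1 < p)).comp_const_add a t
      have h2 := (hasDerivAt_id t).const_mul (p * |a| ^ (p - 2) * a)
      rw [mul_one] at h2
      exact (h1.sub h2).hasDerivWithinAt)
    (fun t ht => by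
      have ht' : |t| ≤ |h| := abs_le.2 ht
      have h1 := abs_rpow_mul_self_sub_le (by linarith : 0 ≤ p - 2) (x := a) (y := a + t)
        (by linarith) ((abs_add_le _ _).trans (by linarith))
      rw [add_sub_cancel_left] at h1
      have hpos : 0 ≤ (p - 1) * (3 : ℝ) ^ (p - 2) :=
        mul_nonneg (by linarith) (Real.rpow_nonneg (by norm_num) _)
      rw [Real.norm_eq_abs, mul_assoc, mul_assoc, ← mul_sub, abs_mul,
        abs_of_nonneg (by linarith : 0 ≤ p), mul_assoc]
      refine mul_le_mul_of_nonneg_left (h1.trans ?_) (by linarith)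
      rw [show p - 2 + 1 = p - 1 by ring]
      exact mul_le_mul_of_nonneg_left ht' hpos)
    (convex_Icc _ _) ⟨by linarith [abs_nonneg h], abs_nonneg h⟩ ⟨neg_abs_le h, le_abs_self h⟩
  simp only [add_zero, mul_zero, sub_zero, Real.norm_eq_abs] at hmv
  have h1 := (le_abs_self _).trans hmv
  have h2 : p * ((p - 1) * 3 ^ (p - 2)) * |h| * |h| = p * ((p - 1) * 3 ^ (p - 2)) * h ^ 2 := by
    rw [mul_assoc, abs_mul_abs_self, sq]
  linarith

/-- Balls inscribed in the unit ball of `ℓ_p`, `2 ≤ p < ∞`. -/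
theorem exists_ellipsoid_of_two_le {d : ℕ} (hd : 0 < d) {p : ℝ} (hp : 2 ≤ p) :
    ∃ κ > 0, ∀ x : Fin d → ℝ, ∑ i, |x i| ^ p ≤ 1 →
      ∃ (c y : Fin d → ℝ) (T : (Fin d → ℝ) →ₗ[ℝ] (Fin d → ℝ)),
        (∀ z : Fin d → ℝ, z ⬝ᵥ z ≤ 1 → ∑ i, |(c + T z) i| ^ p ≤ 1) ∧ y ⬝ᵥ y ≤ 1 ∧ c + T y = x ∧
        κ ≤ |LinearMap.det T| := by
  have hd1 : (1 : ℝ) ≤ d := by exact_mod_cast hd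
  set K₀ : ℝ := p * ((p - 1) * 3 ^ (p - 2)) with hK₀
  have hK₀0 : 0 ≤ K₀ := mul_nonneg (by linarith)
    (mul_nonneg (by linarith) (Real.rpow_nonneg (by norm_num) _))
  -- The extra `p d` only enlarges the quadratic constant; it ensures `r ≤ 1` and keeps every
  -- displacement `|hᵢ| ≤ 2`, the range of the quadratic bound.
  set K : ℝ := K₀ + p * d with hK
  have hpd : p ≤ p * d := le_mul_of_one_le_right (by linarith) hd1
  have hKp : p ≤ K := by linarith
  have hK0 : 0 < K := by linarith
  refine ⟨(1 / (2 * d * K)) ^ d, by positivity, fun x hx => ?_⟩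
  set S : ℝ := ∑ i, |x i| ^ p with hS
  have hterm0 : ∀ i, 0 ≤ |x i| ^ p := fun i => Real.rpow_nonneg (abs_nonneg _) _
  have hx1 : ∀ i, |x i| ≤ 1 := fun i => by
    have : |x i| ^ p ≤ 1 := (Finset.single_le_sum (fun j _ => hterm0 j) (Finset.mem_univ i)).trans hx
    by_contra! hlt
    exact absurd this (not_le.2 (Real.one_lt_rpow hlt (by linarith)))
  set g : Fin d → ℝ := fun i => p * |x i| ^ (p - 2) * x i with hg
  have hq1 : ∀ i, |x i| ^ (p - 2) ≤ 1 := fun i =>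
    Real.rpow_le_one (abs_nonneg _) (hx1 i) (by linarith)
  have hq0 : ∀ i, 0 ≤ |x i| ^ (p - 2) := fun i => Real.rpow_nonneg (abs_nonneg _) _
  have hgp : ∀ i, |g i| ≤ p := fun i => by
    rw [hg]
    simp only [abs_mul, abs_of_nonneg (hq0 i), abs_of_nonneg (by linarith : 0 ≤ p)]
    calc p * |x i| ^ (p - 2) * |x i| ≤ p * 1 * 1 := by
          gcongr
          exacts [hq1 i, hx1 i]
      _ = p := by ring
  have hglow : ∀ i, 4 * (|x i| ^ p) ^ 2 ≤ g i ^ 2 := fun i => by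
    have e : |x i| ^ p = |x i| ^ (p - 2) * x i ^ 2 := by
      rw [← sq_abs (x i), ← Real.rpow_two, ← Real.rpow_add_of_nonneg (abs_nonneg _)
        (by linarith) (by norm_num), sub_add_cancel]
    have hx2 : x i ^ 2 ≤ 1 := (sq_le_one_iff_abs_le_one _).2 (hx1 i)
    rw [e, hg]
    calc 4 * (|x i| ^ (p - 2) * x i ^ 2) ^ 2
        = 2 ^ 2 * (|x i| ^ (p - 2)) ^ 2 * x i ^ 2 * x i ^ 2 := by ring
      _ ≤ p ^ 2 * (|x i| ^ (p - 2)) ^ 2 * x i ^ 2 * 1 := by gcongr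
      _ = (p * |x i| ^ (p - 2) * x i) ^ 2 := by ring
  set G : ℝ := ∑ i, g i ^ 2 with hG
  have hGlow : 4 * S ^ 2 ≤ d * G := by
    have h1 := sq_sum_le_card_mul_sum_sq (s := Finset.univ) (f := fun i => |x i| ^ p)
    rw [Finset.card_univ, Fintype.card_fin] at h1
    have h2 : ∑ i, 4 * (|x i| ^ p) ^ 2 ≤ G := Finset.sum_le_sum fun i _ => hglow i
    rw [← Finset.mul_sum] at h2
    nlinarith
  have hGup : G ≤ d * p ^ 2 := by
    have h1 : G ≤ ∑ i : Fin d, p ^ 2 := Finset.sum_le_sum fun i _ =>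
      sq_le_sq' (abs_le.1 (hgp i)).1 (abs_le.1 (hgp i)).2
    simpa using h1
  have hS0 : 0 ≤ S := Finset.sum_nonneg fun i _ => hterm0 i
  have hG0 : 0 ≤ G := Finset.sum_nonneg fun i _ => sq_nonneg _
  -- Completing the square in `S + ∑ (gᵢhᵢ + K hᵢ²) ≤ 1` gives the ball about `x - g/(2K)` with this
  -- squared radius. It is bounded below: near the boundary `G ≥ 4S²/d` does not vanish, and
  -- elsewhere `1 - S` is large.
  set r2 : ℝ := G / (4 * K ^ 2) + (1 - S) / K with hr2
  have hr2low : (1 / (2 * d * K)) ^ 2 ≤ r2 := by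
    have h1 : S ^ 2 / (d * K ^ 2) ≤ G / (4 * K ^ 2) := by
      rw [div_le_div_iff₀ (by positivity) (by positivity)]
      nlinarith [sq_nonneg K]
    have h2 : (1 - S) / (d * K ^ 2) ≤ (1 - S) / K := by
      apply div_le_div_of_nonneg_left (by linarith) hK0
      nlinarith [mul_le_mul hd1 (by linarith : 1 ≤ K) zero_le_one (by linarith)]
    have h3 : (1 / (2 * d * K)) ^ 2 ≤ (S ^ 2 + (1 - S)) / (d * K ^ 2) := by
      rw [one_div_pow, div_le_div_iff₀ (by positivity) (by positivity)]
      have h4 : 1 / 2 ≤ S ^ 2 + (1 - S) := by nlinarith [sq_nonneg (S - 1 / 2)]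
      have h5 : (d : ℝ) * K ^ 2 ≤ d ^ 2 * K ^ 2 := by
        gcongr
        nlinarith
      nlinarith [sq_nonneg ((d : ℝ) * K)]
    rw [add_div] at h3
    linarith
  have hr2up : r2 ≤ 1 := by
    have h1 : G / (4 * K ^ 2) ≤ 1 / 4 := by
      rw [div_le_div_iff₀ (by positivity) (by norm_num)]
      have : (p * d) ^ 2 ≤ K ^ 2 := by
        apply pow_le_pow_left₀ (by positivity)
        linarith
      nlinarith [mul_nonneg (sq_nonneg p) (by nlinarith : (0 : ℝ) ≤ (d : ℝ) ^ 2 - d)]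
    have h2 : (1 - S) / K ≤ 1 / 2 := by
      rw [div_le_div_iff₀ hK0 (by norm_num)]
      linarith
    linarith
  set r : ℝ := Real.sqrt r2 with hr
  have hr0 : 0 < r := Real.sqrt_pos.2 (lt_of_lt_of_le (by positivity) hr2low)
  have hrr : r ^ 2 = r2 := Real.sq_sqrt (le_trans (by positivity) hr2low)
  have hr1 : r ≤ 1 := Real.sqrt_le_one.2 hr2up
  have hrlow : 1 / (2 * d * K) ≤ r := Real.le_sqrt_of_sq_le hr2low
  refine ⟨x - (1 / (2 * K)) • g, (1 / (2 * K * r)) • g, r • LinearMap.id, fun z hz => ?_, ?_, ?_, ?_⟩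
  · set h : Fin d → ℝ := r • z - (1 / (2 * K)) • g with hh
    have hxh : x - (1 / (2 * K)) • g + (r • LinearMap.id (R := ℝ) (M := Fin d → ℝ)) z = x + h := by
      rw [hh, LinearMap.smul_apply, LinearMap.id_apply]
      abel
    have hz1 : ∀ i, |z i| ≤ 1 := fun i => by
      rw [← sq_le_one_iff_abs_le_one, sq]
      exact (Finset.single_le_sum (f := fun i => z i * z i) (fun j _ => mul_self_nonneg _)
        (Finset.mem_univ i)).trans hz
    have hh2 : ∀ i, |h i| ≤ 2 := fun i => by
      have h1 : |r * z i| ≤ 1 := by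
        rw [abs_mul, abs_of_pos hr0]
        exact mul_le_one₀ hr1 (abs_nonneg _) (hz1 i)
      have h2 : |1 / (2 * K) * g i| ≤ 1 := by
        rw [abs_mul, abs_of_pos (by positivity), one_div_mul_eq_div, div_le_one (by positivity)]
        linarith [hgp i]
      have := abs_sub (r * z i) (1 / (2 * K) * g i)
      simp only [hh, Pi.sub_apply, Pi.smul_apply, smul_eq_mul]
      linarith
    have hterm : ∀ i, |(x + h) i| ^ p ≤ |x i| ^ p + (K * r ^ 2 * (z i * z i) - g i ^ 2 / (4 * K)) := by
      intro i
      have h1 := abs_add_rpow_le hp (hx1 i) (hh2 i)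
      rw [← hK₀] at h1
      have h2 : K₀ * h i ^ 2 ≤ K * h i ^ 2 := by
        gcongr
        rw [hK]
        linarith
      have h3 : g i * h i + K * h i ^ 2 = K * r ^ 2 * (z i * z i) - g i ^ 2 / (4 * K) := by
        simp only [hh, Pi.sub_apply, Pi.smul_apply, smul_eq_mul]
        field_simp
        ring
      change |x i + h i| ^ p ≤ _
      have h4 : p * |x i| ^ (p - 2) * x i * h i = g i * h i := rfl
      linarith
    rw [hxh]
    refine (Finset.sum_le_sum fun i _ => hterm i).trans ?_
    rw [Finset.sum_add_distrib, Finset.sum_sub_distrib, ← Finset.mul_sum, ← Finset.sum_div]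
    have hz' : ∑ i, z i * z i ≤ 1 := hz
    have h5 : K * r ^ 2 * ∑ i, z i * z i ≤ K * r ^ 2 * 1 := by gcongr
    have h6 : K * r ^ 2 = G / (4 * K) + (1 - S) := by
      rw [hrr, hr2]
      field_simp
    linarith
  · rw [smul_dotProduct, dotProduct_smul, smul_eq_mul, smul_eq_mul]
    have h1 : g ⬝ᵥ g = G := Finset.sum_congr rfl fun i _ => (sq (g i)).symm
    have h2 : G / (4 * K ^ 2) ≤ r ^ 2 := by
      rw [hrr, hr2]
      have : 0 ≤ (1 - S) / K := div_nonneg (by linarith) hK0.le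
      linarith
    rw [h1]
    calc 1 / (2 * K * r) * (1 / (2 * K * r) * G) = G / (4 * K ^ 2) / r ^ 2 := by
          field_simp
          ring
      _ ≤ 1 := by rw [div_le_one (by positivity)]; exact h2
  · rw [LinearMap.smul_apply, LinearMap.id_apply, smul_smul,
      show r * (1 / (2 * K * r)) = 1 / (2 * K) by field_simp, sub_add_cancel]
  · rw [LinearMap.det_smul, LinearMap.det_id, mul_one, Module.finrank_fin_fun,
      abs_of_pos (by positivity)]
    gcongr

/-- Ellipsoids inscribed in the cube. -/
theorem exists_ellipsoid_cube {d : ℕ} (hd : 0 < d) {n : ℕ} (hn : 1 ≤ n) {x : Fin d → ℝ}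
    (hx : ∀ i, |x i| ≤ 1) :
    ∃ (c y : Fin d → ℝ) (T : (Fin d → ℝ) →ₗ[ℝ] (Fin d → ℝ)),
      (∀ z : Fin d → ℝ, z ⬝ᵥ z ≤ 1 → ∀ i, |(c + T z) i| ≤ 1) ∧
      y ⬝ᵥ y ≤ 1 + 1 / (100 * n ^ 2) ∧ c + T y = x ∧
      (1 / 4 * (1 / 40) ^ (d - 1)) * (n : ℝ) ^ (1 - (d : ℝ)) ≤ |LinearMap.det T| := by
  have hd1 : (1 : ℝ) ≤ d := by exact_mod_cast hd
  have hn1 : (1 : ℝ) ≤ n := by exact_mod_cast hn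
  -- With `s` the signs of `x`, the half-size cube centred at `x - s/2` lies in the cube and has `x`
  -- as a vertex.
  obtain ⟨s, hs1, hsx⟩ : ∃ s : Fin d → ℝ, (∀ i, s i ^ 2 = 1) ∧ ∀ i, |x i - s i / 2| ≤ 1 / 2 := by
    refine ⟨fun i => if 0 ≤ x i then 1 else -1, fun i => ?_, fun i => ?_⟩
    · by_cases h : 0 ≤ x i <;> simp [h]
    · have := abs_le.1 (hx i)
      by_cases h : 0 ≤ x i
      · simp only [h, if_true]
        exact abs_le.2 ⟨by linarith, by linarith⟩
      · simp only [h, if_false]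
        exact abs_le.2 ⟨by linarith, by linarith⟩
  set D : ℝ := Real.sqrt d with hD
  have hD0 : 0 < D := Real.sqrt_pos.2 (by linarith)
  have hDD : D ^ 2 = d := Real.sq_sqrt (by linarith)
  obtain ⟨e, he⟩ : ∃ e : Fin d → ℝ, e = D⁻¹ • s := ⟨_, rfl⟩
  have hei : ∀ i, e i ^ 2 = 1 / d := fun i => by
    rw [he, Pi.smul_apply, smul_eq_mul, mul_pow, hs1, inv_pow, hDD, mul_one, one_div]
  have hee : e ⬝ᵥ e = 1 := by
    have : ∀ i, e i * e i = 1 / d := fun i => by rw [← sq, hei]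
    rw [dotProduct]
    simp only [this]
    rw [Finset.sum_const, Finset.card_univ, Fintype.card_fin, nsmul_eq_mul,
      mul_one_div_cancel (by linarith)]
  -- A needle along the diagonal with semi-axis `a` and transverse semi-axes `b`: it misses the
  -- vertex by a factor `d/(4a²) ≤ 1 + 16b²` in squared length, and `16b² = 1/(100n²)`.
  obtain ⟨b, hb⟩ : ∃ b : ℝ, b = 1 / (40 * n) := ⟨_, rfl⟩
  have hb0 : 0 < b := by rw [hb]; positivity
  have hb2 : b ^ 2 = 1 / (1600 * n ^ 2) := by rw [hb, one_div_pow]; ring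
  have hb2' : b ^ 2 ≤ 1 / 1600 := by
    rw [hb2]
    apply one_div_le_one_div_of_le <;> nlinarith
  -- Chosen so that every row of the matrix has Euclidean length `1/2`: the needle touches all faces
  -- of the half-size cube.
  set a2 : ℝ := d / 4 - (d - 1) * b ^ 2 with ha2
  have ha2low : 1 / 16 ≤ a2 := by nlinarith
  set a : ℝ := Real.sqrt a2 with ha
  have ha0 : 0 < a := Real.sqrt_pos.2 (by linarith)
  have haa : a ^ 2 = a2 := Real.sq_sqrt (by linarith)
  have halow : 1 / 4 ≤ a := Real.le_sqrt_of_sq_le (by linarith)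
  have hTz : ∀ z : Fin d → ℝ, ((b ^ 2 / a) • parabolicScaling e (a / b)) z =
      b • z + ((a - b) * (e ⬝ᵥ z)) • e := by
    intro z
    rw [LinearMap.smul_apply, parabolicScaling_apply, smul_add, smul_smul, smul_smul]
    congr 2
    · field_simp
    · field_simp
  refine ⟨x - (1 / 2 : ℝ) • s, (D / (2 * a)) • e, (b ^ 2 / a) • parabolicScaling e (a / b),
    fun z hz i => ?_, ?_, ?_, ?_⟩
  · rw [hTz]
    have hrow : (b • z + ((a - b) * (e ⬝ᵥ z)) • e) i =
        (Pi.single i b + ((a - b) * e i) • e) ⬝ᵥ z := by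
      rw [add_dotProduct, smul_dotProduct, single_dotProduct]
      simp only [Pi.add_apply, Pi.smul_apply, smul_eq_mul]
      ring
    have hrow2 : (Pi.single i b + ((a - b) * e i) • e) ⬝ᵥ (Pi.single i b + ((a - b) * e i) • e) =
        1 / 4 := by
      rw [add_dotProduct, dotProduct_add, dotProduct_add, smul_dotProduct, smul_dotProduct,
        dotProduct_smul, dotProduct_smul, single_dotProduct, dotProduct_single, single_dotProduct,
        hee, Pi.single_eq_same]
      simp only [smul_eq_mul]
      have : b * b + (a - b) * e i * (b * e i) + ((a - b) * e i * (e i * b) +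
          (a - b) * e i * ((a - b) * e i * 1)) = b ^ 2 + (a ^ 2 - b ^ 2) * e i ^ 2 := by ring
      rw [this, hei, haa, ha2]
      field_simp
      ring
    have hcs : ((Pi.single i b + ((a - b) * e i) • e) ⬝ᵥ z) ^ 2 ≤ 1 / 4 := by
      refine (Finset.sum_mul_sq_le_sq_mul_sq _ _ _).trans ?_
      have h1 : ∑ j, (Pi.single i b + ((a - b) * e i) • e : Fin d → ℝ) j ^ 2 = 1 / 4 := by
        rw [← hrow2]
        exact Finset.sum_congr rfl fun j _ => sq _
      have h2 : ∑ j, z j ^ 2 ≤ 1 := by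
        refine le_trans (le_of_eq ?_) hz
        exact Finset.sum_congr rfl fun j _ => sq _
      rw [h1]
      linarith
    have hcs' := Real.abs_le_sqrt hcs
    rw [show (1 / 4 : ℝ) = (1 / 2) ^ 2 by norm_num, Real.sqrt_sq (by norm_num), ← hrow] at hcs'
    have h3 := hsx i
    have h4 := abs_add_le (x i - s i / 2) ((b • z + ((a - b) * (e ⬝ᵥ z)) • e) i)
    have h5 : (x - (1 / 2 : ℝ) • s + (b • z + ((a - b) * (e ⬝ᵥ z)) • e)) i =
        x i - s i / 2 + (b • z + ((a - b) * (e ⬝ᵥ z)) • e) i := by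
      simp only [Pi.add_apply, Pi.sub_apply, Pi.smul_apply, smul_eq_mul]
      ring
    rw [h5]
    linarith
  · rw [smul_dotProduct, dotProduct_smul, hee]
    have h1 : (D / (2 * a)) • (D / (2 * a)) • (1 : ℝ) = d / (4 * a2) := by
      rw [smul_eq_mul, smul_eq_mul, mul_one, ← haa, ← hDD]
      field_simp
      norm_num
    have h2 : 1 / (100 * (n : ℝ) ^ 2) = 16 * b ^ 2 := by
      rw [hb2]
      field_simp
      norm_num
    rw [h1, h2, div_le_iff₀ (by linarith)]
    nlinarith [sq_nonneg b, mul_nonneg (sq_nonneg b) (by linarith : (0 : ℝ) ≤ d - 1)]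
  · rw [hTz, dotProduct_smul, hee]
    have : (1 / 2 : ℝ) • s = (D / 2) • e := by
      rw [he, smul_smul]
      congr 1
      field_simp
    rw [this, smul_smul, smul_eq_mul, mul_one]
    have h1 : b * (D / (2 * a)) + (a - b) * (D / (2 * a)) = D / 2 := by
      field_simp
      ring
    rw [← add_smul, h1, sub_add_cancel]
  · rw [LinearMap.det_smul, det_parabolicScaling hee, Module.finrank_fin_fun,
      abs_of_pos (by positivity)]
    obtain ⟨m, rfl⟩ : ∃ m, d = m + 1 := ⟨d - 1, by omega⟩
    have h1 : (b ^ 2 / a) ^ (m + 1) * (a / b) ^ (m + 1 + 1) = a * b ^ m := by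
      rw [div_pow, div_pow, ← pow_mul]
      field_simp
      ring
    have h2 : (n : ℝ) ^ (1 - ((m + 1 : ℕ) : ℝ)) = 1 / (n : ℝ) ^ m := by
      rw [show 1 - ((m + 1 : ℕ) : ℝ) = -(m : ℝ) by push_cast; ring,
        Real.rpow_neg (by positivity), Real.rpow_natCast, one_div]
    rw [h1, h2, Nat.add_sub_cancel, hb]
    have h3 : (1 / (40 * (n : ℝ))) ^ m = (1 / 40) ^ m * (1 / (n : ℝ) ^ m) := by
      rw [← one_div_pow, ← mul_pow]
      congr 1
      field_simp
    rw [h3, mul_assoc]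
    gcongr

/-! ### Two-sided estimates for the three ranges of `p`. -/

theorem approxPow_lpUnitBall_of_le_two {d : ℕ} (hd : 0 < d) {p : ℝ≥0∞} (hp1 : 1 ≤ p)
    (hp2 : p ≤ 2) :
    ApproxPow (christoffelSup (lpUnitBall d p)) (2 * (1 + 1 / p.toReal * ((d : ℝ) - 1))) ∧
    ApproxPow (nikolskiiSup (lpUnitBall d p)) (2 * (1 + 1 / p.toReal * ((d : ℝ) - 1)) / 2) := by
  have hd' : (0 : ℝ) < d := by exact_mod_cast hd
  have hptop : p ≠ ∞ := ne_top_of_le_ne_top ENNReal.ofNat_ne_top hp2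
  have hq1 : 1 ≤ p.toReal := by
    simpa using ENNReal.toReal_mono hptop hp1
  have hq2 : p.toReal ≤ 2 := by
    simpa using ENNReal.toReal_mono ENNReal.ofNat_ne_top hp2
  set q := p.toReal with hq
  have hq0 : 0 < q := by linarith
  have hmem : ∀ x : Fin d → ℝ, x ∈ lpUnitBall d p ↔ ∑ i, |x i| ^ q ≤ 1 := fun x =>
    mem_lpUnitBall_iff hq0
  have hterm0 : ∀ (x : Fin d → ℝ) i, 0 ≤ |x i| ^ q := fun x i =>
    Real.rpow_nonneg (abs_nonneg _) _
  set i₀ : Fin d := ⟨0, hd⟩ with hi₀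
  have habs : ∀ x ∈ lpUnitBall d p, |x i₀| ≤ 1 := fun x hx => by
    have h1 : |x i₀| ^ q ≤ 1 :=
      (Finset.single_le_sum (fun j _ => hterm0 x j) (Finset.mem_univ i₀)).trans ((hmem x).1 hx)
    by_contra! hlt
    exact absurd h1 (not_le.2 (Real.one_lt_rpow hlt hq0))
  refine approxPow_of_ellipsoids_of_caps (convex_lpUnitBall hp1) (isCompact_lpUnitBall hp1)
    (interior_lpUnitBall_nonempty hp1)
    (κ := (1 / d : ℝ) ^ (1 / q - 1 / 2) * ((1 / (200 * d) : ℝ) ^ (1 / q - 1 / 2)) ^ (d - 1))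
    (by positivity) (fun n hn x hx => ?_)
    (LinearEquiv.refl ℝ _) i₀ (x₀ := Pi.single i₀ 1) (C := q ^ (1 / q)) (γ := 1 / q) ?_
    (by simp) (by positivity) (by positivity) rfl (fun x hx => (abs_le.1 (habs x hx)).2)
    (fun x hx => (abs_le.1 (habs x hx)).1) (fun x hx j hj => ?_)
  · obtain ⟨c, y, T, h1, h2, h3, h4⟩ := exists_ellipsoid_of_le_two hd hq1 hq2 hn ((hmem x).1 hx)
    exact ⟨c, y, T, fun z hz => (hmem _).2 (h1 z hz), h2, h3, h4⟩
  · rw [hmem, Finset.sum_eq_single i₀ (fun j _ hj => by simp [hj, hq0.ne']) (by simp)]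
    simp
  · simp only [LinearEquiv.refl_apply, Pi.single_eq_of_ne hj, sub_zero]
    have h1 : |x j| ^ q + |x i₀| ^ q ≤ 1 := by
      refine le_trans ?_ ((hmem x).1 hx)
      rw [← Finset.sum_pair (f := fun i => |x i| ^ q) hj]
      exact Finset.sum_le_sum_of_subset_of_nonneg (Finset.subset_univ _) fun i _ _ => hterm0 x i
    -- Bernoulli: `|x_{i₀}|^q ≥ 1 - q(1 - |x_{i₀}|)`, so what is left for `|x_j|^q` is at most `q(1
    -- - x_{i₀})`, a cap of width exponent `1/q`.
    have h2 := one_add_mul_self_le_rpow_one_add (s := |x i₀| - 1) (by linarith [abs_nonneg (x i₀)])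
      hq1
    rw [add_sub_cancel] at h2
    have h3 : |x j| ^ q ≤ q * (1 - x i₀) := by nlinarith [le_abs_self (x i₀)]
    have h4 : 0 ≤ 1 - x i₀ := by linarith [(abs_le.1 (habs x hx)).2]
    rw [← Real.mul_rpow hq0.le h4]
    calc |x j| = (|x j| ^ q) ^ (1 / q) := by
          rw [← Real.rpow_mul (abs_nonneg _), mul_one_div_cancel hq0.ne', Real.rpow_one]
      _ ≤ _ := Real.rpow_le_rpow (hterm0 x j) h3 (by positivity)

/-- Power-mean inequality. The `ℓ_q` ball lies in this Euclidean ball and touches its sphere at the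
diagonal points, which is why caps there have width exponent `1/2`. -/
theorem sum_sq_le_of_sum_rpow_le_one {d : ℕ} (hd : 0 < d) {q : ℝ} (hq : 2 ≤ q) {x : Fin d → ℝ}
    (hx : ∑ i, |x i| ^ q ≤ 1) : ∑ i, x i ^ 2 ≤ (d : ℝ) ^ (1 - 2 / q) := by
  have hd' : (0 : ℝ) < d := by exact_mod_cast hd
  have h0 : 0 ≤ ∑ i, x i ^ 2 := Finset.sum_nonneg fun i _ => sq_nonneg _
  have h1 := Real.rpow_sum_le_const_mul_sum_rpow (s := Finset.univ) (f := fun i => x i ^ 2)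
    (p := q / 2) (by linarith)
  have e : ∀ i, |x i ^ 2| ^ (q / 2) = |x i| ^ q := fun i => by
    rw [abs_pow, ← Real.rpow_two, ← Real.rpow_mul (abs_nonneg _)]
    congr 1
    ring
  simp only [e] at h1
  simp only [abs_pow, sq_abs, Finset.card_univ, Fintype.card_fin] at h1
  have hdp : 0 ≤ (d : ℝ) ^ (q / 2 - 1) := by positivity
  have h2 : (∑ i, x i ^ 2) ^ (q / 2) ≤ (d : ℝ) ^ (q / 2 - 1) :=
    h1.trans (mul_le_of_le_one_right hdp hx)
  have h3 := Real.rpow_le_rpow (Real.rpow_nonneg h0 _) h2 (by positivity : 0 ≤ 2 / q)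
  rw [← Real.rpow_mul h0, ← Real.rpow_mul hd'.le] at h3
  have hq0 : q ≠ 0 := by linarith
  rwa [show q / 2 * (2 / q) = 1 by field_simp, Real.rpow_one,
    show (q / 2 - 1) * (2 / q) = 1 - 2 / q by field_simp] at h3

theorem approxPow_lpUnitBall_of_two_le {d : ℕ} (hd : 0 < d) {p : ℝ≥0∞} (hp2 : 2 ≤ p)
    (hptop : p ≠ ∞) :
    ApproxPow (christoffelSup (lpUnitBall d p)) ((d : ℝ) + 1) ∧
    ApproxPow (nikolskiiSup (lpUnitBall d p)) (((d : ℝ) + 1) / 2) := by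
  have hd' : (0 : ℝ) < d := by exact_mod_cast hd
  have hp1 : 1 ≤ p := le_trans one_le_two hp2
  have hq2 : 2 ≤ p.toReal := by
    simpa using ENNReal.toReal_mono hptop hp2
  set q := p.toReal with hq
  have hq0 : 0 < q := by linarith
  have hmem : ∀ x : Fin d → ℝ, x ∈ lpUnitBall d p ↔ ∑ i, |x i| ^ q ≤ 1 := fun x =>
    mem_lpUnitBall_iff hq0
  set i₀ : Fin d := ⟨0, hd⟩ with hi₀
  obtain ⟨κ, hκ, hell⟩ := exists_ellipsoid_of_two_le hd hq2
  -- The peak is at `(v, …, v)`; `a` normalises the sum functional to 1 there, and `B = d v²` is the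
  -- squared radius of the circumscribed Euclidean ball.
  set v : ℝ := (d : ℝ) ^ (-(1 / q)) with hv
  set a : ℝ := (d : ℝ) ^ (1 / q - 1) with ha
  set B : ℝ := (d : ℝ) ^ (1 - 2 / q) with hB
  have hv0 : 0 < v := Real.rpow_pos_of_pos hd' _
  have ha0 : 0 < a := Real.rpow_pos_of_pos hd' _
  have hB0 : 0 < B := Real.rpow_pos_of_pos hd' _
  have hav : a * (d * v) = 1 := by
    rw [ha, hv]
    nth_rewrite 2 [← Real.rpow_one (d : ℝ)]
    rw [← Real.rpow_add hd', ← Real.rpow_add hd', ← Real.rpow_zero (d : ℝ)]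
    congr 1
    ring
  have hvB : v = B * a := by
    rw [hv, hB, ha, ← Real.rpow_add hd']
    congr 1
    ring
  have hBv : d * v ^ 2 = B := by
    have : v * (a * (d * v)) = B * a := by rw [hav, mul_one, hvB]
    have h2 : a * (d * v ^ 2) = a * B := by linarith
    exact mul_left_cancel₀ ha0.ne' h2
  -- Expand `|x - s(v, …, v)|²` inside the Euclidean ball. The sign `s = 1` controls the caps;
  -- nonnegativity for `s = ±1` gives both bounds on the functional.
  have hquad : ∀ x ∈ lpUnitBall d p, ∀ s : ℝ, s ^ 2 = 1 →
      ∑ i, (x i - s * v) ^ 2 ≤ 2 * B * (1 - s * (a * ∑ i, x i)) := by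
    intro x hx s hs
    have h1 := sum_sq_le_of_sum_rpow_le_one hd hq2 ((hmem x).1 hx)
    have h2 : ∑ i, (x i - s * v) ^ 2 = ∑ i, x i ^ 2 - 2 * s * v * ∑ i, x i + d * v ^ 2 := by
      have : ∀ i, (x i - s * v) ^ 2 = x i ^ 2 - 2 * s * v * x i + v ^ 2 := fun i => by
        rw [sub_sq, mul_pow, hs]; ring
      simp only [this]
      rw [Finset.sum_add_distrib, Finset.sum_sub_distrib, ← Finset.mul_sum, Finset.sum_const,
        Finset.card_univ, Fintype.card_fin, nsmul_eq_mul]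
    rw [h2, hBv, hvB]
    linarith
  have hnn : ∀ x ∈ lpUnitBall d p, ∀ s : ℝ, s ^ 2 = 1 → 0 ≤ 1 - s * (a * ∑ i, x i) := by
    intro x hx s hs
    have h1 := (Finset.sum_nonneg fun i _ => sq_nonneg (x i - s * v)).trans (hquad x hx s hs)
    exact nonneg_of_mul_nonneg_right h1 (by positivity)
  refine approxPow_of_ellipsoids_of_caps (convex_lpUnitBall hp1) (isCompact_lpUnitBall hp1)
    (interior_lpUnitBall_nonempty hp1) hκ (fun n hn x hx => ?_)
    (sumShear i₀ a ha0.ne') i₀ (x₀ := fun _ => v) (C := Real.sqrt (2 * B)) (γ := 1 / 2) ?_ ?_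
    (by positivity) (by norm_num) (by ring) (fun x hx => ?_) (fun x hx => ?_)
    (fun x hx j hj => ?_)
  · obtain ⟨c, y, T, h1, h2, h3, h4⟩ := hell x ((hmem x).1 hx)
    refine ⟨c, y, T, fun z hz => (hmem _).2 (h1 z hz), h2.trans ?_, h3, ?_⟩
    · have : (0 : ℝ) ≤ 1 / (100 * n ^ 2) := by positivity
      linarith
    · rwa [sub_self, Real.rpow_zero, mul_one]
  · rw [hmem, Finset.sum_const, Finset.card_univ, Fintype.card_fin, nsmul_eq_mul,
      abs_of_pos hv0, hv, ← Real.rpow_mul hd'.le]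
    rw [show -(1 / q) * q = -1 by field_simp, Real.rpow_neg_one, mul_inv_cancel₀ hd'.ne']
  · rw [sumShear_apply_self, Finset.sum_const, Finset.card_univ, Fintype.card_fin, nsmul_eq_mul,
      hav]
  · rw [sumShear_apply_self]
    linarith [hnn x hx 1 (by norm_num)]
  · rw [sumShear_apply_self]
    linarith [hnn x hx (-1) (by norm_num)]
  · rw [sumShear_apply_self, sumShear_apply_of_ne hj, sumShear_apply_of_ne hj,
      ← Real.sqrt_eq_rpow, ← Real.sqrt_mul (by positivity)]
    apply Real.abs_le_sqrt
    have h1 := hquad x hx 1 (by norm_num)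
    rw [one_mul, one_mul] at h1
    exact (Finset.single_le_sum (f := fun i => (x i - v) ^ 2) (fun i _ => sq_nonneg _)
      (Finset.mem_univ j)).trans h1

theorem approxPow_lpUnitBall_top {d : ℕ} (hd : 0 < d) :
    ApproxPow (christoffelSup (lpUnitBall d ∞)) (2 * (d : ℝ)) ∧
    ApproxPow (nikolskiiSup (lpUnitBall d ∞)) (2 * (d : ℝ) / 2) := by
  have hd' : (0 : ℝ) < d := by exact_mod_cast hd
  have hp1 : (1 : ℝ≥0∞) ≤ ∞ := le_top
  set i₀ : Fin d := ⟨0, hd⟩ with hi₀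
  have ha0 : (1 / d : ℝ) ≠ 0 := by positivity
  -- The depth below the vertex `(1, …, 1)` is, up to the factor `d`, the sum of the nonnegative `1
  -- - xᵢ`, so it dominates each of them: width exponent 1.
  have hsum : ∀ x : Fin d → ℝ, ∑ i, (1 - x i) = d * (1 - 1 / d * ∑ i, x i) := fun x => by
    rw [Finset.sum_sub_distrib, Finset.sum_const, Finset.card_univ, Fintype.card_fin, nsmul_eq_mul]
    field_simp
  have hsum' : ∀ x : Fin d → ℝ, ∑ i, (1 + x i) = d * (1 + 1 / d * ∑ i, x i) := fun x => by
    rw [Finset.sum_add_distrib, Finset.sum_const, Finset.card_univ, Fintype.card_fin, nsmul_eq_mul]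
    field_simp
  refine approxPow_of_ellipsoids_of_caps (convex_lpUnitBall hp1) (isCompact_lpUnitBall hp1)
    (interior_lpUnitBall_nonempty hp1) (κ := 1 / 4 * (1 / 40) ^ (d - 1)) (by positivity)
    (fun n hn x hx => ?_)
    (sumShear i₀ (1 / d) ha0) i₀ (x₀ := fun _ => 1) (C := d) (γ := 1) ?_ ?_
    hd' zero_le_one (by ring) (fun x hx => ?_) (fun x hx => ?_) (fun x hx j hj => ?_)
  · obtain ⟨c, y, T, h1, h2, h3, h4⟩ := exists_ellipsoid_cube hd hn (mem_lpUnitBall_top_iff.1 hx)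
    refine ⟨c, y, T, fun z hz => mem_lpUnitBall_top_iff.2 (h1 z hz), h2, h3, ?_⟩
    rwa [show (d : ℝ) + 1 - 2 * d = 1 - d by ring]
  · rw [mem_lpUnitBall_top_iff]
    simp
  · rw [sumShear_apply_self]
    simp [hd'.ne']
  · rw [sumShear_apply_self]
    have h1 : 0 ≤ ∑ i, (1 - x i) := Finset.sum_nonneg fun i _ => by
      linarith [(abs_le.1 (mem_lpUnitBall_top_iff.1 hx i)).2]
    rw [hsum] at h1
    linarith [nonneg_of_mul_nonneg_right h1 hd']
  · rw [sumShear_apply_self]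
    have h1 : 0 ≤ ∑ i, (1 + x i) := Finset.sum_nonneg fun i _ => by
      linarith [(abs_le.1 (mem_lpUnitBall_top_iff.1 hx i)).1]
    rw [hsum'] at h1
    linarith [nonneg_of_mul_nonneg_right h1 hd']
  · rw [sumShear_apply_self, sumShear_apply_of_ne hj, sumShear_apply_of_ne hj, Real.rpow_one,
      ← hsum, abs_sub_comm]
    have h0 : ∀ i, 0 ≤ 1 - x i := fun i => by
      linarith [(abs_le.1 (mem_lpUnitBall_top_iff.1 hx i)).2]
    rw [abs_of_nonneg (h0 j)]
    exact Finset.single_le_sum (f := fun i => 1 - x i) (fun i _ => h0 i) (Finset.mem_univ j)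

theorem mainTheorem1 (d : ℕ) (hd : 2 ≤ d) :
    (∀ p : ℝ≥0∞, 1 ≤ p →
      ApproxPow (christoffelSup (lpUnitBall d p)) (lpBallExponent d p) ∧
      ApproxPow (nikolskiiSup (lpUnitBall d p)) (lpBallExponent d p / 2)) ∧
    (∀ σ : ℝ, (d : ℝ) + 1 ≤ σ → σ ≤ 2 * (d : ℝ) →
      ∃ D : Set (Fin d → ℝ), Convex ℝ D ∧ IsCompact D ∧ (interior D).Nonempty ∧
        ApproxPow (christoffelSup D) σ ∧ ApproxPow (nikolskiiSup D) (σ / 2)) := by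
  have hd0 : 0 < d := by omega
  have hd2 : (2 : ℝ) ≤ d := by exact_mod_cast hd
  refine ⟨fun p hp => ?_, fun σ hσ1 hσ2 => ?_⟩
  · by_cases h2 : p ≤ 2
    · rw [lpBallExponent, if_pos h2,
        show 2 + 2 / p.toReal * ((d : ℝ) - 1) = 2 * (1 + 1 / p.toReal * ((d : ℝ) - 1)) by ring]
      exact approxPow_lpUnitBall_of_le_two hd0 hp h2
    · by_cases htop : p = ∞
      · subst htop
        rw [lpBallExponent, if_neg h2, if_neg (lt_irrefl _)]
        exact approxPow_lpUnitBall_top hd0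
      · rw [lpBallExponent, if_neg h2, if_pos (lt_top_iff_ne_top.2 htop)]
        exact approxPow_lpUnitBall_of_two_le hd0 (not_le.1 h2).le htop
  · have hσ0 : 0 < σ - 2 := by linarith
    -- Solves `σ = 2 + (2/q)(d - 1)`; the bounds `σ ≤ 2d` and `σ ≥ d + 1` become `q ≥ 1` and `q ≤
    -- 2`.
    set q : ℝ := 2 * ((d : ℝ) - 1) / (σ - 2) with hq
    have hq1 : 1 ≤ q := by rw [hq, le_div_iff₀ hσ0]; linarith
    have hq2 : q ≤ 2 := by rw [hq, div_le_iff₀ hσ0]; linarith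
    have hp1 : 1 ≤ ENNReal.ofReal q := ENNReal.one_le_ofReal.2 hq1
    have hp2 : ENNReal.ofReal q ≤ 2 := by
      simpa using ENNReal.ofReal_le_ofReal hq2
    refine ⟨lpUnitBall d (ENNReal.ofReal q), convex_lpUnitBall hp1, isCompact_lpUnitBall hp1,
      interior_lpUnitBall_nonempty hp1, ?_⟩
    have h := approxPow_lpUnitBall_of_le_two hd0 hp1 hp2
    have e : 2 * (1 + 1 / (ENNReal.ofReal q).toReal * ((d : ℝ) - 1)) = σ := by
      have : (d : ℝ) - 1 ≠ 0 := by linarith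
      rw [ENNReal.toReal_ofReal (by linarith), hq]
      field_simp
      ring
    rwa [e] at h
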